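/- Let $d\ge 3$ and let $B$ be a spherically symmetric Schwartz function on $\mathbb R^d$ such that $0$ lies in the support of its Fourier transform $\widehat B(q)=\int_{\mathbb R^d} e^{-2\pi i q\cdot x}B(x)\,dx$. Put $e(p)=\tfrac12p^2$. For $\alpha\ge0$ and any $r'\in\mathbb R^d$ with $e(r')=\alpha$ let $$\Theta(\alpha)=\lim_{\varepsilon\to0+}\int_{\mathbb R^d}\frac{|\widehat B(q-r')|^2}{\alpha-e(q)+i\varepsilon}\,dq,\qquad \mathcal I(\alpha)=-\operatorname{Im}\Theta(\alpha)$$ (the limit exists and does not depend on the choice of $r'$), and set $\Theta(\alpha)=0$, $\mathcal I(\alpha)=0$ for $\alpha<0$. For $\lambda>0$ let $\omega(p)=e(p)+\lambda^2\Theta(e(p))$. For a function $h$ on $\mathbb R^d$ and $\gamma\in\mathbb R$ write $$\int h(p)\,\delta(e(p)-\gamma)\,dp=\int_{\{q\,:\,e(q)=\gamma\}}h(q)\,\frac{d\nu(q)}{|\nabla e(q)|},$$ where $\nu$ is the surface measure on the sphere $\{e(q)=\gamma\}$ (for $\gamma\le 0$ this integral is $0$). Let $\langle p\rangle=(2+p^2)^{1/2}$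 and $\|f\|_{4d,1}=\sum_{|a|\le1}\|\langle p\rangle^{4d}\partial^a f\|_\infty$. There are constants $C,\lambda_0>0$, depending only on $d$ and $B$, such that the following holds for all real $\kappa<1/8$, all $0<\lambda\le\lambda_0$, all $\eta$ with $\lambda^{2+4\kappa}\le\eta\le\lambda^{2+\kappa}$, all $\alpha,\beta\in\mathbb R$, all $r\in\mathbb R^d$ with $|r|\le\lambda^{2+\kappa/4}$, and all $C^1$ functions $f:\mathbb R^d\to\mathbb C$ with $\|f\|_{4d,1}<\infty$. With $\gamma=(\alpha+\beta)/2$, both integrals below converge absolutely and $$\left|\int_{\mathbb R^d}\frac{\lambda^2f(p)\,dp}{\big(\alpha-\overline{\omega}(p-r)-i\eta\big)\big(\beta-\omega(p+r)+i\eta\big)}+2\pi i\lambda^2\int\frac{f(p)\,\delta(e(p)-\gamma)}{(\alpha-\beta)+2p\cdot r-2i[\lambda^2\mathcal I(\gamma)+\eta]}\,dp\right|\le C\,\lambda^{1/2-4\kappa}\,\|f\|_{4d,1}.$$ -/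

import Mathlib

open MeasureTheory Filter Topology
open scoped SchwartzMap FourierTransform ENNReal

noncomputable section

namespace RandomSchrodinger

/-- Momentum space: `ℝ^d` with the Euclidean norm. -/
abbrev Mom (d : ℕ) : Type := EuclideanSpace ℝ (Fin d)

/-- The dispersion relation `e(p) = p² / 2`. -/
def kin {d : ℕ} (p : Mom d) : ℝ := ‖p‖ ^ 2 / 2

/-- The regularized self-energy
`Θ_ε(α, r) = ∫ |B̂(q - r)|² / (α - e(q) + iε) dq`,
with `B̂(q) = ∫ exp(-2π i q·x) B(x) dx`. -/
def selfEnergyReg {d : ℕ} (B : 𝓢(Mom d, ℂ)) (ε α : ℝ) (r : Mom d) : ℂ :=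
  ∫ q : Mom d, ((‖(𝓕 (B : Mom d → ℂ)) (q - r)‖ ^ 2 : ℝ) : ℂ) /
    ((α : ℂ) - (kin q : ℂ) + Complex.I * (ε : ℂ))

open Classical in
/-- The self-energy `Θ(α) = lim_{ε → 0+} Θ_ε(α, r)` for any `r` with `e(r) = α`.
Energies `α < 0` are not attained by `e`; there the value is set to `0`. -/
def selfEnergy {d : ℕ} (B : 𝓢(Mom d, ℂ)) (α : ℝ) : ℂ :=
  if h : ∃ r : Mom d, kin r = α then
    limUnder (𝓝[>] (0 : ℝ)) (fun ε : ℝ => selfEnergyReg B ε α h.choose)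
  else 0

/-- `I(α) = - Im Θ(α)`. -/
def selfEnergyIm {d : ℕ} (B : 𝓢(Mom d, ℂ)) (α : ℝ) : ℝ := -(selfEnergy B α).im

/-- The renormalized dispersion relation `ω(p) = e(p) + lam² θ(p)`, `θ(p) = Θ(e(p))`. -/
def renDisp {d : ℕ} (B : 𝓢(Mom d, ℂ)) (lam : ℝ) (p : Mom d) : ℂ :=
  (kin p : ℂ) + (lam : ℂ) ^ 2 * selfEnergy B (kin p)

/-- The surface measure `ν` (restriction of Lebesgue measure) on the energy surface
`Σ_γ = {q : e(q) = γ}`, as a measure on `ℝ^d`.  For `γ ≥ 0` this surface is the sphere of radius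
`√(2γ)`, and `ν` is the image of the surface measure of the unit sphere under
`θ ↦ √(2γ) θ`, multiplied by `√(2γ)^(d-1)`.  For `γ < 0` the surface is empty. -/
def shellMeasure (d : ℕ) (γ : ℝ) : Measure (Mom d) :=
  if 0 ≤ γ then
    ENNReal.ofReal (Real.sqrt (2 * γ) ^ (d - 1)) •
      ((volume : Measure (Mom d)).toSphere).map
        (fun θ : Metric.sphere (0 : Mom d) 1 => Real.sqrt (2 * γ) • (θ : Mom d))
  else 0

/-- `∫ h(p) δ(e(p) - γ) dp = ∫_{Σ_γ} h(q) / |∇e(q)| dν(q)`, where `∇e(q) = q`. -/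
def deltaIntegral {d : ℕ} (h : Mom d → ℂ) (γ : ℝ) : ℂ :=
  ∫ q, h q / ((‖q‖ : ℝ) : ℂ) ∂(shellMeasure d γ)

/-- `⟨x⟩ = (2 + x²)^{1/2}`. -/
def bracket {d : ℕ} (x : Mom d) : ℝ := Real.sqrt (2 + ‖x‖ ^ 2)

/-- The norm `‖f‖_{m,1} = ∑_{|a| ≤ 1} ‖⟨x⟩^m ∂^a f‖_∞` with values in `[0, ∞]`:
the multi-index `a = 0` and the `d` first order partial derivatives. -/
def weightedC1Norm {d : ℕ} (m : ℕ) (f : Mom d → ℂ) : ℝ≥0∞ :=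
  (⨆ x : Mom d, ENNReal.ofReal (bracket x ^ m * ‖f x‖)) +
    ∑ i : Fin d, ⨆ x : Mom d,
      ENNReal.ofReal (bracket x ^ m * ‖fderiv ℝ f x (EuclideanSpace.single i (1 : ℝ))‖)

/-- The integrand `lam² f(p) / ((α - ω̄(p - r) - iη) (β - ω(p + r) + iη))`. -/
def twoResolvent {d : ℕ} (B : 𝓢(Mom d, ℂ)) (lam η α β : ℝ) (r : Mom d) (f : Mom d → ℂ)
    (p : Mom d) : ℂ :=
  (lam : ℂ) ^ 2 * f p /
    (((α : ℂ) - (starRingEnd ℂ) (renDisp B lam (p - r)) - Complex.I * (η : ℂ)) *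
      ((β : ℂ) - renDisp B lam (p + r) + Complex.I * (η : ℂ)))

/-- The function `f(p) / ((α - β) + 2 p·r - 2i (lam² I(γ) + η))` with `γ = (α + β) / 2`. -/
def onShellFun {d : ℕ} (B : 𝓢(Mom d, ℂ)) (lam η α β : ℝ) (r : Mom d) (f : Mom d → ℂ)
    (p : Mom d) : ℂ :=
  f p / (((α : ℂ) - (β : ℂ)) + 2 * ((inner ℝ p r : ℝ) : ℂ) -
    2 * Complex.I * ((lam ^ 2 * selfEnergyIm B ((α + β) / 2) + η : ℝ) : ℂ))

end RandomSchrodinger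

end

noncomputable section

namespace RandomSchrodinger

open Complex Set

/-! The proof has two halves: regularity of the self-energy, and a one-dimensional comparison along
rays.

Regularity. Writing the resolvent as a Laplace integral in time gives Θ(e(r)) = -i ∫₀^∞ S(t,r) dt,
where S(t,r) = ∫ |B̂(k)|² exp(-it(k²/2 + k·r)) dk. By Fourier duality with a Gaussian, S(t,r) is a
prefactor of size t^(-d/2), times the phase exp(it e(r)), times a factor bounded and Lipschitz in r
uniformly in t (`oscIntegral_fourier`). Since d ≥ 3 the decay t^(-3/2) makes the time integral
converge. Changing the energy by Δ costs at most min(2, tΔ) t^(-3/2), whose integral is of order √Δ.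
So Θ is bounded and Hölder-1/2 in the energy, and its imaginary part is nonpositive
(`selfEnergy_regularity`).

Comparison. In polar coordinates with radial variable u = e(p), the momentum integral becomes an
average over directions of integrals over u > 0. Along each ray both inverse resolvents are close to
affine functions of u; freezing their coefficients at u = γ and replacing the ray density g(u) by
g(γ) leaves an integral over ℝ that equals -2πi divided by the on-shell denominator
(`integral_resolvent_pair`). Each freezing error is O(λ²(√|u-γ| + λ)), up to momentum growth
absorbed by the weight of f; the error from g is O(√|u-γ|).

The gain comes from γ being the midpoint of α and β: |u-γ| ≤ |X| + |Y| + O(λ²) for the two inverse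
resolvents X and Y, so a factor √|u-γ| in the numerator cancels half a power of a denominator. As
|X| and |Y| are comparable from below to η plus a distance to some center, ∫ (√|u-γ| + λ)/|XY| du =
O(λ/η) (`pair_integral_le`). A freezing error costs a further λ²/η, from the third resolvent. With
the prefactor λ² the total is O(λ³/η + λ⁵/η²), which is O(λ^(1/2-4κ)) in the allowed range of η
(`scale_bounds`). -/

/-! ### Rotation invariance of the regularized self-energy -/

/-- The squared modulus of the Fourier transform of `B`, as a Schwartz function. -/
def spectralDensity {d : ℕ} (B : 𝓢(Mom d, ℂ)) : 𝓢(Mom d, ℂ) :=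
  SchwartzMap.bilinLeftCLM (ContinuousLinearMap.mul ℝ ℂ)
    ((𝓕 B : 𝓢(Mom d, ℂ)).postcompCLM (Complex.conjCLE : ℂ →L[ℝ] ℂ)).hasTemperateGrowth
    (𝓕 B : 𝓢(Mom d, ℂ))

lemma spectralDensity_apply {d : ℕ} (B : 𝓢(Mom d, ℂ)) (k : Mom d) :
    spectralDensity B k = ((‖(𝓕 (B : Mom d → ℂ)) k‖ ^ 2 : ℝ) : ℂ) := by
  simp [spectralDensity, SchwartzMap.bilinLeftCLM_apply, SchwartzMap.postcompCLM_apply,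
    SchwartzMap.fourier_coe, Complex.mul_conj, Complex.normSq_eq_norm_sq]

/-- The reflection exchanging two vectors of equal length preserves Lebesgue measure and e, and it
preserves B̂ because B is radial. This makes the arbitrary choice of momentum in `selfEnergy`
harmless. -/
lemma selfEnergyReg_comp_isometry {d : ℕ} (B : 𝓢(Mom d, ℂ))
    (hB : ∀ x y : Mom d, ‖x‖ = ‖y‖ → B x = B y) (ε α : ℝ) {r r' : Mom d} (h : ‖r‖ = ‖r'‖) :
    selfEnergyReg B ε α r = selfEnergyReg B ε α r' := by
  obtain ⟨A, hA⟩ : ∃ A : Mom d ≃ₗᵢ[ℝ] Mom d, A r = r' := ⟨_, Submodule.reflection_sub h⟩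
  have hF : ∀ k, 𝓕 (B : Mom d → ℂ) (A k) = 𝓕 (B : Mom d → ℂ) k := by
    intro k
    rw [← Real.fourier_comp_linearIsometry]
    have hc : (B : Mom d → ℂ) ∘ A = B := funext fun x => hB _ _ (A.norm_map x)
    rw [hc]
  have := MeasurePreserving.integral_comp A.measurePreserving A.toHomeomorph.measurableEmbedding
    (fun q => ((‖(𝓕 (B : Mom d → ℂ)) (q - r')‖ ^ 2 : ℝ) : ℂ) /
    ((α : ℂ) - (kin q : ℂ) + Complex.I * (ε : ℂ)))
  unfold selfEnergyReg
  rw [← this]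
  congr 1
  ext q
  rw [← hA, ← map_sub, hF]
  simp [kin]

/-! ### Dispersive decay of the oscillatory integrals -/

/-- The oscillatory integral `∫ φ(k) exp(-it(k²/2 + k·r)) dk`. -/
def oscIntegral {d : ℕ} (φ : 𝓢(Mom d, ℂ)) (t : ℝ) (r : Mom d) : ℂ :=
  ∫ k, φ k * cexp (-(t * (‖k‖ ^ 2 / 2 + inner ℝ k r) : ℝ) * I)

lemma norm_cexp_neg_ofReal_mul_I (x : ℝ) : ‖cexp (-(x : ℂ) * I)‖ = 1 := by
  rw [← ofReal_neg, Complex.norm_exp_ofReal_mul_I]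

lemma norm_oscIntegral_le {d : ℕ} (φ : 𝓢(Mom d, ℂ)) (t : ℝ) (r : Mom d) :
    ‖oscIntegral φ t r‖ ≤ ∫ k, ‖φ k‖ := by
  refine (norm_integral_le_integral_norm _).trans (le_of_eq ?_)
  simp only [norm_mul, norm_cexp_neg_ofReal_mul_I, mul_one]

lemma continuous_oscIntegral {d : ℕ} (φ : 𝓢(Mom d, ℂ)) (r : Mom d) :
    Continuous fun t => oscIntegral φ t r := by
  refine continuous_of_dominated (bound := fun k => ‖φ k‖) ?_ ?_ ?_ ?_
  · intro t
    apply Continuous.aestronglyMeasurable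
    have := φ.continuous
    fun_prop
  · intro t
    refine Eventually.of_forall fun k => ?_
    simp only [norm_mul, norm_cexp_neg_ofReal_mul_I, mul_one, le_refl]
  · exact φ.integrable.norm
  · refine Eventually.of_forall fun k => ?_
    fun_prop

lemma norm_cexp_ofReal_mul_I_sub_le (x y : ℝ) : ‖cexp (x * I) - cexp (y * I)‖ ≤ |x - y| := by
  have h : cexp (x * I) - cexp (y * I) = cexp (y * I) * (cexp (I * (x - y : ℝ)) - 1) := by
    rw [mul_sub, ← Complex.exp_add, mul_one]
    congr 2
    push_cast; ring
  rw [h, norm_mul, Complex.norm_exp_ofReal_mul_I, one_mul]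
  exact Real.norm_exp_I_mul_ofReal_sub_one_le

lemma norm_oscIntegral_sub_le {d : ℕ} (φ : 𝓢(Mom d, ℂ)) {t : ℝ} (ht : 0 ≤ t) (r r' : Mom d) :
    ‖oscIntegral φ t r - oscIntegral φ t r'‖ ≤ t * ‖r - r'‖ * ∫ k, ‖k‖ * ‖φ k‖ := by
  have hint : ∀ r : Mom d,
      Integrable fun k => φ k * cexp (-(t * (‖k‖ ^ 2 / 2 + inner ℝ k r) : ℝ) * I) := by
    intro r
    refine φ.integrable.norm.mono' ?_ ?_
    · apply Continuous.aestronglyMeasurable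
      have := φ.continuous
      fun_prop
    · refine Eventually.of_forall fun k => ?_
      simp only [norm_mul, norm_cexp_neg_ofReal_mul_I, mul_one, le_refl]
  unfold oscIntegral
  rw [← integral_sub (hint r) (hint r'), ← integral_const_mul]
  refine norm_integral_le_of_norm_le ?_ (Eventually.of_forall fun k => ?_)
  · have := (φ.integrable_pow_mul volume 1).const_mul (t * ‖r - r'‖)
    simpa using this
  · rw [← mul_sub, norm_mul]
    have h1 := norm_cexp_ofReal_mul_I_sub_le (-(t * (‖k‖ ^ 2 / 2 + inner ℝ k r)))
      (-(t * (‖k‖ ^ 2 / 2 + inner ℝ k r')))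
    rw [ofReal_neg, ofReal_neg] at h1
    have h2 : -(t * (‖k‖ ^ 2 / 2 + inner ℝ k r)) - -(t * (‖k‖ ^ 2 / 2 + inner ℝ k r'))
        = -(t * inner ℝ k (r - r')) := by
      rw [inner_sub_right]; ring
    rw [h2, abs_neg, abs_mul, abs_of_nonneg ht] at h1
    have h3 := abs_real_inner_le_norm k (r - r')
    calc _ ≤ ‖φ k‖ * (t * (‖k‖ * ‖r - r'‖)) := by
          gcongr
          exact h1.trans (by gcongr)
      _ = _ := by ring

/-- The duality ∫ ŵ v = ∫ w v̂ applied to a Gaussian v; the damping δ > 0 makes v integrable. -/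
lemma oscIntegral_gaussian {d : ℕ} (w : 𝓢(Mom d, ℂ)) {t : ℝ} (r : Mom d) {δ : ℝ}
    (hδ : 0 < δ) :
    ∫ k, (𝓕 w : 𝓢(Mom d, ℂ)) k * cexp (-(δ + t / 2 * I) * ‖k‖ ^ 2
        + 2 * Real.pi * I * (inner ℝ (-(t / (2 * Real.pi)) • r) k : ℝ)) =
      (Real.pi / (δ + t / 2 * I)) ^ (d / 2 : ℂ) *
        ∫ x, w x * cexp (-Real.pi ^ 2 * ‖(-(t / (2 * Real.pi)) • r) - x‖ ^ 2 / (δ + t / 2 * I)) := by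
  have hb : 0 < ((δ : ℂ) + t / 2 * I).re := by simpa using hδ
  have J := GaussianFourier.integrable_cexp_neg_mul_sq_norm_add hb (2 * Real.pi * I)
    (-(t / (2 * Real.pi)) • r)
  have h := VectorFourier.integral_fourierIntegral_smul_eq_flip (L := innerₗ (Mom d))
      Real.continuous_fourierChar continuous_inner (w.integrable (μ := volume)) J
  rw [← integral_const_mul]
  refine Eq.trans ?_ (h.trans ?_)
  · rfl
  · refine integral_congr_ae (Eventually.of_forall fun x => ?_)
    have := fourier_gaussian_innerProductSpace' hb (-(t / (2 * Real.pi)) • r) x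
    simp only [finrank_euclideanSpace, Fintype.card_fin] at this
    simp only [smul_eq_mul]
    rw [mul_left_comm, ← this]
    simp [Real.fourier_eq]
    left
    rfl

/-- The limit δ → 0+ of the damped identity, with the square on the right expanded. The momentum r
then enters only through the phase exp(it e(r)) and the linear phase 2π r·x, whose coefficient does
not grow with t. -/
lemma oscIntegral_fourier {d : ℕ} (w : 𝓢(Mom d, ℂ)) {t : ℝ} (ht : 0 < t) (r : Mom d) :
    oscIntegral (𝓕 w) t r = (Real.pi / (t / 2 * I)) ^ (d / 2 : ℂ) *
      (cexp ((t * (‖r‖ ^ 2 / 2) : ℝ) * I) *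
        ∫ x, w x * cexp ((2 * Real.pi * inner ℝ r x + 2 * Real.pi ^ 2 * ‖x‖ ^ 2 / t : ℝ) * I)) := by
  have ht' : (t : ℂ) ≠ 0 := by exact_mod_cast ht.ne'
  have hpi : (Real.pi : ℂ) ≠ 0 := by exact_mod_cast Real.pi_ne_zero
  have hden : ∀ δ : ℝ, (δ : ℂ) + t / 2 * I ≠ 0 := by
    intro δ h
    have := congrArg Complex.im h
    simp at this
    exact ht.ne' this
  have hδ0 : Tendsto (fun δ : ℝ => (δ : ℂ) + t / 2 * I) (𝓝[>] 0) (𝓝 (t / 2 * I)) := by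
    have : Continuous fun δ : ℝ => (δ : ℂ) + t / 2 * I := by fun_prop
    simpa using this.tendsto 0 |>.mono_left nhdsWithin_le_nhds
  have h0 : (t : ℂ) / 2 * I ≠ 0 := by simpa using hden 0
  have hL : Tendsto (fun δ : ℝ => ∫ k, (𝓕 w : 𝓢(Mom d, ℂ)) k * cexp (-(δ + t / 2 * I) * ‖k‖ ^ 2
        + 2 * Real.pi * I * (inner ℝ (-(t / (2 * Real.pi)) • r) k : ℝ))) (𝓝[>] 0)
      (𝓝 (oscIntegral (𝓕 w) t r)) := by
    refine tendsto_integral_filter_of_dominated_convergence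
      (fun k => ‖(𝓕 w : 𝓢(Mom d, ℂ)) k‖) ?_ ?_ (𝓕 w : 𝓢(Mom d, ℂ)).integrable.norm ?_
    · refine Eventually.of_forall fun δ => Continuous.aestronglyMeasurable ?_
      have := (𝓕 w : 𝓢(Mom d, ℂ)).continuous
      fun_prop
    · filter_upwards [self_mem_nhdsWithin] with δ hδ
      refine Eventually.of_forall fun k => ?_
      rw [norm_mul, Complex.norm_exp]
      refine mul_le_of_le_one_right (norm_nonneg _) (Real.exp_le_one_iff.2 ?_)
      have hδ : 0 < δ := hδ
      have : (-(δ + t / 2 * I) * (‖k‖ : ℂ) ^ 2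
        + 2 * Real.pi * I * (inner ℝ (-(t / (2 * Real.pi)) • r) k : ℝ)).re = -(δ * ‖k‖ ^ 2) := by
        have e : (‖k‖ : ℂ) ^ 2 = ((‖k‖ ^ 2 : ℝ) : ℂ) := (ofReal_pow _ _).symm
        rw [e]
        simp [-ofReal_pow]
      rw [this]
      have := mul_nonneg hδ.le (sq_nonneg ‖k‖)
      linarith
    · refine Eventually.of_forall fun k => Tendsto.const_mul _ ?_
      refine (Complex.continuous_exp.tendsto _).comp ?_
      have h2 := ((hδ0.neg.mul_const ((‖k‖ : ℂ) ^ 2)).add_const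
        (2 * Real.pi * I * (inner ℝ (-(t / (2 * Real.pi)) • r) k : ℝ)))
      convert h2 using 2
      rw [inner_smul_left, real_inner_comm r k]
      simp only [conj_trivial]
      push_cast
      field_simp
      ring
  have hR : Tendsto (fun δ : ℝ => (Real.pi / (δ + t / 2 * I)) ^ (d / 2 : ℂ) *
        ∫ x, w x * cexp (-Real.pi ^ 2 * ‖(-(t / (2 * Real.pi)) • r) - x‖ ^ 2 / (δ + t / 2 * I)))
      (𝓝[>] 0) (𝓝 ((Real.pi / (t / 2 * I)) ^ (d / 2 : ℂ) *
        ∫ x, w x * cexp (-Real.pi ^ 2 * ‖(-(t / (2 * Real.pi)) • r) - x‖ ^ 2 / (t / 2 * I)))) := by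
    refine Tendsto.mul ?_ ?_
    · refine (continuousAt_cpow_const ?_).tendsto.comp (tendsto_const_nhds.div hδ0 h0)
      -- The base lies on the negative imaginary axis, off the branch cut, so the power is
      -- continuous there.
      right
      have : (Real.pi : ℂ) / (t / 2 * I) = ((-(2 * Real.pi / t) : ℝ) : ℂ) * I := by
        push_cast
        field_simp
        simp
      rw [this]
      simp [ht.ne', Real.pi_ne_zero]
    · refine tendsto_integral_filter_of_dominated_convergence
        (fun k => ‖w k‖) ?_ ?_ w.integrable.norm ?_
      · refine Eventually.of_forall fun δ => Continuous.aestronglyMeasurable ?_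
        have := w.continuous
        fun_prop
      · filter_upwards [self_mem_nhdsWithin] with δ hδ
        refine Eventually.of_forall fun k => ?_
        rw [norm_mul, Complex.norm_exp]
        refine mul_le_of_le_one_right (norm_nonneg _) (Real.exp_le_one_iff.2 ?_)
        have hδ : 0 < δ := hδ
        have : (-(Real.pi : ℂ) ^ 2 * (‖(-(t / (2 * Real.pi)) • r) - k‖ : ℂ) ^ 2 / (δ + t / 2 * I))
          = ((-Real.pi ^ 2 * ‖(-(t / (2 * Real.pi)) • r) - k‖ ^ 2 : ℝ) : ℂ) * (δ + t / 2 * I)⁻¹ := by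
          push_cast; rw [div_eq_mul_inv]
        rw [this, Complex.re_ofReal_mul, Complex.inv_re]
        refine mul_nonpos_of_nonpos_of_nonneg ?_ (div_nonneg (by simpa using hδ.le) (normSq_nonneg _))
        rw [neg_mul]
        exact neg_nonpos.2 (by positivity)
      · refine Eventually.of_forall fun k => Tendsto.const_mul _ ?_
        exact (Complex.continuous_exp.tendsto _).comp (tendsto_const_nhds.div hδ0 h0)
  have hLR : oscIntegral (𝓕 w) t r = _ := tendsto_nhds_unique hL (hR.congr' (by
    filter_upwards [self_mem_nhdsWithin] with δ hδ
    exact (oscIntegral_gaussian w r hδ).symm))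
  rw [hLR]
  refine congrArg (HMul.hMul _) ?_
  rw [← integral_const_mul]
  refine integral_congr_ae (Eventually.of_forall fun x => ?_)
  beta_reduce
  rw [mul_left_comm, ← Complex.exp_add]
  congr 2
  have hn : (‖(-(t / (2 * Real.pi)) • r) - x‖ : ℂ) ^ 2 =
      ((t / (2 * Real.pi)) ^ 2 * ‖r‖ ^ 2 + t / Real.pi * inner ℝ r x + ‖x‖ ^ 2 : ℝ) := by
    rw [← ofReal_pow, norm_sub_sq_real, inner_smul_left, norm_smul, mul_pow, norm_neg,
      Real.norm_eq_abs, sq_abs]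
    congr 1
    simp
    ring
  rw [hn]
  push_cast
  field_simp
  ring_nf
  simp
  ring

/-- The majorant `min (t ^ (-1/2) / a) (t ^ (-3/2))`, whose integral is `4 / √a`. -/
def timeMajorant (a t : ℝ) : ℝ :=
  if t ≤ a then t ^ (-1 / 2 : ℝ) / a else t ^ (-3 / 2 : ℝ)

lemma timeMajorant_integrableOn {a : ℝ} (ha : 0 < a) :
    IntegrableOn (timeMajorant a) (Ioi 0) ∧ ∫ t in Ioi 0, timeMajorant a t = 4 / √a := by
  have h1 : IntegrableOn (timeMajorant a) (Ioc 0 a) := by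
    have : IntegrableOn (fun t : ℝ => t ^ (-1 / 2 : ℝ) / a) (Ioc 0 a) := by
      rw [← intervalIntegrable_iff_integrableOn_Ioc_of_le ha.le]
      exact (intervalIntegral.intervalIntegrable_rpow' (by norm_num)).div_const _
    refine this.congr_fun (fun t ht => ?_) measurableSet_Ioc
    simp [timeMajorant, ht.2]
  have h2 : IntegrableOn (timeMajorant a) (Ioi a) := by
    refine (integrableOn_Ioi_rpow_of_lt (by norm_num : (-3 / 2 : ℝ) < -1) ha).congr_fun
      (fun t ht => ?_) measurableSet_Ioi
    simp [timeMajorant, not_le.2 (mem_Ioi.1 ht)]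
  have hu : Ioc 0 a ∪ Ioi a = Ioi (0 : ℝ) := Ioc_union_Ioi_eq_Ioi ha.le
  refine ⟨hu ▸ h1.union h2, ?_⟩
  rw [← hu, setIntegral_union (Ioc_disjoint_Ioi le_rfl) measurableSet_Ioi h1 h2]
  have e1 : ∫ t in Ioc 0 a, timeMajorant a t = 2 / √a := by
    rw [setIntegral_congr_fun (g := fun t : ℝ => t ^ (-1 / 2 : ℝ) / a) measurableSet_Ioc
      (fun t ht => by simp [timeMajorant, ht.2])]
    rw [← intervalIntegral.integral_of_le ha.le, intervalIntegral.integral_div,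
      integral_rpow (Or.inl (by norm_num))]
    norm_num
    rw [← Real.sqrt_eq_rpow]
    have := Real.sqrt_pos.2 ha
    field_simp
    rw [Real.sq_sqrt ha.le]
  have e2 : ∫ t in Ioi a, timeMajorant a t = 2 / √a := by
    rw [setIntegral_congr_fun (g := fun t : ℝ => t ^ (-3 / 2 : ℝ)) measurableSet_Ioi
      (fun t ht => by simp [timeMajorant, not_le.2 (mem_Ioi.1 ht)])]
    rw [integral_Ioi_rpow_of_lt (by norm_num) ha]
    norm_num
    rw [Real.rpow_neg ha.le, ← Real.sqrt_eq_rpow]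
    field_simp
  rw [e1, e2]
  ring

lemma rpow_le_timeMajorant_one {t : ℝ} (ht : 1 ≤ t) : t ^ (-3 / 2 : ℝ) ≤ timeMajorant 1 t := by
  unfold timeMajorant
  split_ifs with h
  · have : t = 1 := le_antisymm h ht
    simp [this]
  · exact le_rfl

lemma one_le_timeMajorant_one {t : ℝ} (ht : 0 < t) (ht1 : t ≤ 1) : 1 ≤ timeMajorant 1 t := by
  simp only [timeMajorant, ht1, if_true, div_one]
  exact Real.one_le_rpow_of_pos_of_le_one_of_nonpos ht ht1 (by norm_num)

lemma timeMajorant_nonneg {a t : ℝ} (ha : 0 < a) (ht : 0 ≤ t) : 0 ≤ timeMajorant a t := by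
  unfold timeMajorant
  split_ifs <;> positivity

/-- The two entries of the minimum cross near t = 1/Δ; splitting there yields a majorant with
integral of order √Δ, the source of the Hölder exponent 1/2. -/
lemma min_mul_rpow_le_timeMajorant {t Δ : ℝ} (ht : 0 < t) (hΔ : 0 < Δ) :
    min 2 (t * Δ) * t ^ (-3 / 2 : ℝ) ≤ 2 * timeMajorant (1 / Δ) t := by
  unfold timeMajorant
  split_ifs with h
  · have h3 : t ^ (-1 / 2 : ℝ) = t * t ^ (-3 / 2 : ℝ) := by
      rw [← Real.rpow_one_add' ht.le (by norm_num)]; norm_num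
    have hp : 0 < t ^ (-3 / 2 : ℝ) := by positivity
    rw [div_div_eq_mul_div, div_one, h3]
    calc _ ≤ t * Δ * t ^ (-3 / 2 : ℝ) := by gcongr; exact min_le_right _ _
      _ ≤ 2 * (t * Δ * t ^ (-3 / 2 : ℝ)) := by linarith [mul_pos (mul_pos ht hΔ) hp]
      _ = _ := by ring
  · gcongr
    exact min_le_left _ _

lemma norm_gaussian_prefactor_le {d : ℕ} (hd : 3 ≤ d) {t : ℝ} (ht : 1 ≤ t) :
    ‖((Real.pi : ℂ) / (t / 2 * I)) ^ (d / 2 : ℂ)‖ ≤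
      (2 * Real.pi) ^ (d / 2 : ℝ) * t ^ (-3 / 2 : ℝ) := by
  have ht0 : 0 < t := by linarith
  have e : (d / 2 : ℂ) = ((d / 2 : ℝ) : ℂ) := by push_cast; rfl
  have hd' : (3 : ℝ) ≤ d := by exact_mod_cast hd
  rw [e, Complex.norm_cpow_real]
  have : ‖(Real.pi : ℂ) / (t / 2 * I)‖ = 2 * Real.pi * t⁻¹ := by
    simp [abs_of_pos ht0, abs_of_pos Real.pi_pos]
    field_simp
  rw [this, Real.mul_rpow (by positivity) (by positivity), Real.inv_rpow ht0.le,
    ← Real.rpow_neg ht0.le]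
  gcongr ?_ * ?_
  exact Real.rpow_le_rpow_of_exponent_le ht (by linarith)

lemma norm_cexp_sub_le_min (x y : ℝ) : ‖cexp (x * I) - cexp (y * I)‖ ≤ min 2 |x - y| := by
  refine le_min ?_ (norm_cexp_ofReal_mul_I_sub_le x y)
  refine (norm_sub_le _ _).trans ?_
  rw [norm_exp_ofReal_mul_I, norm_exp_ofReal_mul_I]
  norm_num

lemma oscIntegral_bounds {d : ℕ} (hd : 3 ≤ d) (φ : 𝓢(Mom d, ℂ)) :
    ∃ C : ℝ, 0 ≤ C ∧ ∀ t : ℝ, 1 ≤ t → ∀ r r' : Mom d,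
      ‖oscIntegral φ t r‖ ≤ C * t ^ (-3 / 2 : ℝ) ∧
      ‖oscIntegral φ t r - oscIntegral φ t r'‖ ≤
        C * (min 2 (t * |kin r - kin r'|) * t ^ (-3 / 2 : ℝ) + ‖r - r'‖ * t ^ (-3 / 2 : ℝ)) := by
  obtain ⟨w, hw⟩ : ∃ w : 𝓢(Mom d, ℂ), 𝓕 w = φ :=
    ⟨𝓕⁻ φ, FourierTransform.fourier_fourierInv_eq φ⟩
  set P := (2 * Real.pi) ^ (d / 2 : ℝ) with hP
  have hP0 : 0 ≤ P := by positivity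
  set W := ∫ x, ‖w x‖ with hW
  set W1 := ∫ x, ‖x‖ * ‖w x‖ with hW1
  have hW0 : 0 ≤ W := integral_nonneg fun _ => norm_nonneg _
  have hW10 : 0 ≤ W1 := integral_nonneg fun _ => by positivity
  refine ⟨P * (W + 2 * Real.pi * W1), by positivity, fun t ht r r' => ?_⟩
  have ht0 : 0 < t := by linarith
  set J : Mom d → ℂ := fun r => ∫ x, w x *
    cexp ((2 * Real.pi * inner ℝ r x + 2 * Real.pi ^ 2 * ‖x‖ ^ 2 / t : ℝ) * I) with hJ
  set E : Mom d → ℂ := fun r => cexp ((t * (‖r‖ ^ 2 / 2) : ℝ) * I) with hE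
  have hEn : ∀ r, ‖E r‖ = 1 := fun r => norm_exp_ofReal_mul_I _
  have hosc : ∀ r, oscIntegral φ t r = (Real.pi / (t / 2 * I)) ^ (d / 2 : ℂ) * (E r * J r) := by
    intro r
    rw [← hw, oscIntegral_fourier w ht0]
  have hint : ∀ r : Mom d, Integrable fun x => w x *
      cexp ((2 * Real.pi * inner ℝ r x + 2 * Real.pi ^ 2 * ‖x‖ ^ 2 / t : ℝ) * I) := by
    intro r
    refine w.integrable.norm.mono' ?_ (Eventually.of_forall fun k => ?_)
    · apply Continuous.aestronglyMeasurable
      have := w.continuous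
      fun_prop
    · simp only [norm_mul, norm_exp_ofReal_mul_I, mul_one, le_refl]
  have hJn : ∀ r, ‖J r‖ ≤ W := by
    intro r
    refine (norm_integral_le_integral_norm _).trans (le_of_eq ?_)
    simp only [norm_mul, norm_exp_ofReal_mul_I, mul_one, hW]
  have hJd : ‖J r - J r'‖ ≤ 2 * Real.pi * ‖r - r'‖ * W1 := by
    simp only [hJ]
    rw [← integral_sub (hint r) (hint r'), hW1, ← integral_const_mul]
    refine norm_integral_le_of_norm_le ?_ (Eventually.of_forall fun k => ?_)
    · simpa using (w.integrable_pow_mul volume 1).const_mul (2 * Real.pi * ‖r - r'‖)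
    · rw [← mul_sub, norm_mul]
      have h1 := norm_cexp_ofReal_mul_I_sub_le
        (2 * Real.pi * inner ℝ r k + 2 * Real.pi ^ 2 * ‖k‖ ^ 2 / t)
        (2 * Real.pi * inner ℝ r' k + 2 * Real.pi ^ 2 * ‖k‖ ^ 2 / t)
      have h2 : 2 * Real.pi * inner ℝ r k + 2 * Real.pi ^ 2 * ‖k‖ ^ 2 / t -
          (2 * Real.pi * inner ℝ r' k + 2 * Real.pi ^ 2 * ‖k‖ ^ 2 / t)
          = 2 * Real.pi * inner ℝ (r - r') k := by
        rw [inner_sub_left]; ring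
      rw [h2, abs_mul, abs_of_pos (by positivity : 0 < 2 * Real.pi)] at h1
      have h3 := abs_real_inner_le_norm (r - r') k
      calc _ ≤ ‖w k‖ * (2 * Real.pi * (‖r - r'‖ * ‖k‖)) := by
            gcongr
            exact h1.trans (by gcongr)
        _ = _ := by ring
  have hpre := norm_gaussian_prefactor_le hd ht
  have htp : 0 < t ^ (-3 / 2 : ℝ) := by positivity
  constructor
  · rw [hosc, norm_mul, norm_mul, hEn, one_mul]
    calc _ ≤ P * t ^ (-3 / 2 : ℝ) * W := by gcongr; exact hJn r
      _ = P * W * t ^ (-3 / 2 : ℝ) := by ring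
      _ ≤ _ := by gcongr; linarith [mul_nonneg (by positivity : 0 ≤ 2 * Real.pi) hW10]
  · rw [hosc, hosc, ← mul_sub, norm_mul]
    have hEd : ‖E r - E r'‖ ≤ min 2 (t * |kin r - kin r'|) := by
      have := norm_cexp_sub_le_min (t * (‖r‖ ^ 2 / 2)) (t * (‖r'‖ ^ 2 / 2))
      rwa [← mul_sub, abs_mul, abs_of_pos ht0] at this
    have hm0 : 0 ≤ min 2 (t * |kin r - kin r'|) := (norm_nonneg _).trans hEd
    have hd2 : ‖E r * J r - E r' * J r'‖ ≤
        min 2 (t * |kin r - kin r'|) * W + 2 * Real.pi * ‖r - r'‖ * W1 := by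
      -- The variation of the phase E is governed by the energy difference, that of J by the
      -- momentum difference.
      have : E r * J r - E r' * J r' = (E r - E r') * J r + E r' * (J r - J r') := by ring
      rw [this]
      refine (norm_add_le _ _).trans ?_
      rw [norm_mul, norm_mul, hEn, one_mul]
      gcongr
      exact hJn r
    calc _ ≤ P * t ^ (-3 / 2 : ℝ) *
          (min 2 (t * |kin r - kin r'|) * W + 2 * Real.pi * ‖r - r'‖ * W1) := by gcongr
      _ ≤ P * t ^ (-3 / 2 : ℝ) *
          (min 2 (t * |kin r - kin r'|) * (W + 2 * Real.pi * W1) +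
            ‖r - r'‖ * (W + 2 * Real.pi * W1)) := by
          have q1 : 0 ≤ min 2 (t * |kin r - kin r'|) * (2 * Real.pi * W1) := by positivity
          have q2 : 0 ≤ ‖r - r'‖ * W := by positivity
          refine mul_le_mul_of_nonneg_left ?_ (by positivity)
          linarith
      _ = _ := by ring

/-- Dispersive decay serves for t ≥ 1; for t ≤ 1 the trivial bounds suffice because `timeMajorant 1`
is at least 1 there. -/
lemma oscIntegral_majorant {d : ℕ} (hd : 3 ≤ d) (φ : 𝓢(Mom d, ℂ)) :
    ∃ C : ℝ, 0 ≤ C ∧ ∀ t : ℝ, 0 < t → ∀ r r' : Mom d,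
      ‖oscIntegral φ t r‖ ≤ C * timeMajorant 1 t ∧
      (0 < |kin r - kin r'| → ‖oscIntegral φ t r - oscIntegral φ t r'‖ ≤
        C * (2 * timeMajorant (1 / |kin r - kin r'|) t + ‖r - r'‖ * timeMajorant 1 t)) := by
  obtain ⟨C, hC, h⟩ := oscIntegral_bounds hd φ
  set W := ∫ x, ‖φ x‖ with hW
  set W1 := ∫ x, ‖x‖ * ‖φ x‖ with hW1
  have hW0 : 0 ≤ W := integral_nonneg fun _ => norm_nonneg _
  have hW10 : 0 ≤ W1 := integral_nonneg fun _ => by positivity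
  refine ⟨C + W + W1, by positivity, fun t ht r r' => ?_⟩
  have hM := timeMajorant_nonneg one_pos ht.le
  rcases le_total t 1 with h1 | h1
  · have hM1 := one_le_timeMajorant_one ht h1
    refine ⟨(norm_oscIntegral_le φ t r).trans ?_, fun hΔ => ?_⟩
    · calc W ≤ W * timeMajorant 1 t := le_mul_of_one_le_right hW0 hM1
        _ ≤ _ := by gcongr; linarith
    · refine (norm_oscIntegral_sub_le φ ht.le r r').trans ?_
      have hMΔ := timeMajorant_nonneg (one_div_pos.2 hΔ) ht.le
      calc t * ‖r - r'‖ * W1 ≤ 1 * ‖r - r'‖ * W1 := by gcongr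
        _ = W1 * (0 + ‖r - r'‖ * 1) := by ring
        _ ≤ (C + W + W1) * (2 * timeMajorant (1 / |kin r - kin r'|) t
            + ‖r - r'‖ * timeMajorant 1 t) := by
          gcongr
          · linarith
          · positivity
  · have hM1 := rpow_le_timeMajorant_one h1
    refine ⟨(h t h1 r r').1.trans ?_, fun hΔ => (h t h1 r r').2.trans ?_⟩
    · gcongr; linarith
    · have := min_mul_rpow_le_timeMajorant ht hΔ
      gcongr
      linarith

/-! ### The self-energy as a time integral, and its regularity -/

/-- The time integral of the oscillatory integrals; the self-energy is `-i` times it. -/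
def timeIntegral {d : ℕ} (φ : 𝓢(Mom d, ℂ)) (r : Mom d) : ℂ := ∫ t in Ioi (0 : ℝ), oscIntegral φ t r

lemma timeIntegral_bounds {d : ℕ} (hd : 3 ≤ d) (φ : 𝓢(Mom d, ℂ)) :
    ∃ C : ℝ, 0 ≤ C ∧ ∀ r r' : Mom d, ‖timeIntegral φ r‖ ≤ C ∧
      (0 < |kin r - kin r'| →
        ‖timeIntegral φ r - timeIntegral φ r'‖ ≤ C * (√|kin r - kin r'| + ‖r - r'‖)) := by
  obtain ⟨C, hC, h⟩ := oscIntegral_majorant hd φ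
  obtain ⟨i1, e1⟩ := timeMajorant_integrableOn one_pos
  have hint : ∀ r, IntegrableOn (fun t => oscIntegral φ t r) (Ioi 0) := by
    intro r
    refine Integrable.mono' (i1.const_mul C) (continuous_oscIntegral φ r).aestronglyMeasurable ?_
    filter_upwards [ae_restrict_mem measurableSet_Ioi] with t ht
    exact (h t ht r r).1
  refine ⟨8 * C, by positivity, fun r r' => ⟨?_, fun hΔ => ?_⟩⟩
  · calc _ ≤ ∫ t in Ioi 0, C * timeMajorant 1 t := by
          refine norm_integral_le_of_norm_le (i1.const_mul C) ?_
          filter_upwards [ae_restrict_mem measurableSet_Ioi] with t ht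
          exact (h t ht r r).1
      _ = 4 * C := by rw [integral_const_mul, e1]; simp; ring
      _ ≤ 8 * C := by linarith
  · obtain ⟨i2, e2⟩ := timeMajorant_integrableOn (one_div_pos.2 hΔ)
    unfold timeIntegral
    rw [← integral_sub (hint r) (hint r')]
    calc _ ≤ ∫ t in Ioi 0, C * (2 * timeMajorant (1 / |kin r - kin r'|) t
            + ‖r - r'‖ * timeMajorant 1 t) := by
          refine norm_integral_le_of_norm_le
            (((i2.const_mul 2).add (i1.const_mul ‖r - r'‖)).const_mul C) ?_
          filter_upwards [ae_restrict_mem measurableSet_Ioi] with t ht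
          exact (h t ht r r').2 hΔ
      _ = C * (8 * √|kin r - kin r'| + 4 * ‖r - r'‖) := by
          rw [integral_const_mul, integral_add (i2.const_mul 2) (i1.const_mul ‖r - r'‖),
            integral_const_mul, integral_const_mul, e1, e2]
          simp
          ring_nf
          simp
      _ ≤ _ := by nlinarith [mul_nonneg hC (norm_nonneg (r - r'))]

/-- After the shift q = k + r the denominator is -(k²/2 + k·r) + iε. Its inverse is a Laplace
integral in t, and the damping exp(-εt) justifies Fubini. -/
lemma selfEnergyReg_eq {d : ℕ} (B : 𝓢(Mom d, ℂ)) {ε : ℝ} (hε : 0 < ε) (r : Mom d) :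
    selfEnergyReg B ε (kin r) r =
      -I * ∫ t in Ioi (0 : ℝ), Real.exp (-(ε * t)) * oscIntegral (spectralDensity B) t r := by
  set φ := spectralDensity B with hφ
  set a : Mom d → ℂ := fun k => -(((‖k‖ ^ 2 / 2 + inner ℝ k r : ℝ) : ℂ) * I) - ε with ha
  have hare : ∀ k, (a k).re = -ε := by intro k; simp [ha, -ofReal_add, -ofReal_div]
  have ha0 : ∀ k, a k ≠ 0 := by
    intro k h
    have := hare k
    rw [h] at this
    simp at this
    exact hε.ne' this
  have hac : Continuous a := by fun_prop
  have h1 : selfEnergyReg B ε (kin r) r = -I * ∫ k, ∫ t in Ioi (0 : ℝ), φ k * cexp (a k * t) := by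
    unfold selfEnergyReg
    rw [← integral_add_right_eq_self _ r, ← integral_const_mul]
    refine integral_congr_ae (Eventually.of_forall fun k => ?_)
    beta_reduce
    rw [integral_const_mul, integral_exp_mul_complex_Ioi (by rw [hare]; linarith), add_sub_cancel_right,
      ← spectralDensity_apply]
    have hk : (kin r : ℂ) - (kin (k + r) : ℂ) + I * ε = -I * a k := by
      have : kin (k + r) = ‖k‖ ^ 2 / 2 + inner ℝ k r + kin r := by
        simp only [kin]
        rw [norm_add_sq_real]; ring
      rw [this, ha]
      push_cast
      ring_nf
      simp
      ring
    rw [hk]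
    have := ha0 k
    simp
    field_simp
    simp [hφ]
  rw [h1, integral_integral_swap]
  · congr 1
    refine integral_congr_ae (Eventually.of_forall fun t => ?_)
    beta_reduce
    rw [oscIntegral, ← integral_const_mul]
    refine integral_congr_ae (Eventually.of_forall fun k => ?_)
    beta_reduce
    rw [mul_left_comm, ofReal_exp, ← Complex.exp_add]
    congr 2
    simp only [ha]
    push_cast
    ring
  · have hb : Integrable (fun z : Mom d × ℝ => ‖φ z.1‖ * Real.exp (-ε * z.2))
        (volume.prod (volume.restrict (Ioi 0))) :=
      φ.integrable.norm.mul_prod (integrableOn_exp_mul_Ioi (by linarith) 0)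
    refine hb.mono' ?_ (Eventually.of_forall fun z => ?_)
    · apply Continuous.aestronglyMeasurable
      have := φ.continuous
      simp only [Function.uncurry_def]
      fun_prop
    · simp only [Function.uncurry_def, norm_mul, Complex.norm_exp]
      rw [Complex.re_mul_ofReal, hare]

lemma tendsto_selfEnergyReg {d : ℕ} (hd : 3 ≤ d) (B : 𝓢(Mom d, ℂ)) (r : Mom d) :
    Tendsto (fun ε : ℝ => selfEnergyReg B ε (kin r) r) (𝓝[>] 0)
      (𝓝 (-I * timeIntegral (spectralDensity B) r)) := by
  obtain ⟨C, hC, h⟩ := oscIntegral_majorant hd (spectralDensity B)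
  obtain ⟨i1, -⟩ := timeMajorant_integrableOn one_pos
  have : Tendsto (fun ε : ℝ => -I * ∫ t in Ioi (0 : ℝ),
      Real.exp (-(ε * t)) * oscIntegral (spectralDensity B) t r) (𝓝[>] 0)
      (𝓝 (-I * timeIntegral (spectralDensity B) r)) := by
    refine Tendsto.const_mul _ ?_
    refine tendsto_integral_filter_of_dominated_convergence (fun t => C * timeMajorant 1 t)
      ?_ ?_ (i1.const_mul C) ?_
    · refine Eventually.of_forall fun ε => Continuous.aestronglyMeasurable ?_
      have := continuous_oscIntegral (spectralDensity B) r
      fun_prop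
    · filter_upwards [self_mem_nhdsWithin] with ε hε
      filter_upwards [ae_restrict_mem measurableSet_Ioi] with t ht
      have hε : 0 < ε := hε
      have ht : 0 < t := ht
      rw [norm_mul, Complex.norm_real, Real.norm_eq_abs, Real.abs_exp]
      refine (mul_le_of_le_one_left (norm_nonneg _) ?_).trans (h t ht r r).1
      exact Real.exp_le_one_iff.2 (by nlinarith [mul_pos hε ht])
    · refine Eventually.of_forall fun t => ?_
      have : Continuous fun ε : ℝ =>
          (Real.exp (-(ε * t)) : ℂ) * oscIntegral (spectralDensity B) t r := by fun_prop
      have := this.tendsto 0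
      simp only [zero_mul, neg_zero, Real.exp_zero, ofReal_one, one_mul] at this
      exact this.mono_left nhdsWithin_le_nhds
  refine this.congr' ?_
  filter_upwards [self_mem_nhdsWithin] with ε hε
  exact (selfEnergyReg_eq B hε r).symm

lemma norm_eq_of_kin_eq {d : ℕ} {x y : Mom d} (h : kin x = kin y) : ‖x‖ = ‖y‖ := by
  unfold kin at h
  exact (sq_eq_sq₀ (norm_nonneg _) (norm_nonneg _)).1 (by linarith)

lemma selfEnergy_kin {d : ℕ} (hd : 3 ≤ d) (B : 𝓢(Mom d, ℂ))
    (hB : ∀ x y : Mom d, ‖x‖ = ‖y‖ → B x = B y) (r : Mom d) :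
    selfEnergy B (kin r) = -I * timeIntegral (spectralDensity B) r := by
  have hex : ∃ r' : Mom d, kin r' = kin r := ⟨r, rfl⟩
  have hn : ‖hex.choose‖ = ‖r‖ := norm_eq_of_kin_eq hex.choose_spec
  rw [selfEnergy, dif_pos hex]
  refine Tendsto.limUnder_eq ?_
  refine (tendsto_selfEnergyReg hd B r).congr fun ε => ?_
  exact (selfEnergyReg_comp_isometry B hB ε _ hn).symm

lemma selfEnergyReg_im_nonpos {d : ℕ} (B : 𝓢(Mom d, ℂ)) {ε : ℝ} (hε : 0 < ε) (r : Mom d) :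
    (selfEnergyReg B ε (kin r) r).im ≤ 0 := by
  have hint : Integrable fun q : Mom d => ((‖(𝓕 (B : Mom d → ℂ)) (q - r)‖ ^ 2 : ℝ) : ℂ) /
      ((kin r : ℂ) - (kin q : ℂ) + Complex.I * (ε : ℂ)) := by
    have h0 : ∀ q : Mom d, (kin r : ℂ) - (kin q : ℂ) + Complex.I * (ε : ℂ) ≠ 0 := by
      intro q h
      have := congrArg Complex.im h
      simp at this
      exact hε.ne' this
    have hb : Integrable fun q : Mom d => ‖spectralDensity B (q - r)‖ * ε⁻¹ :=
      ((spectralDensity B).integrable.norm.comp_sub_right r).mul_const _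
    refine hb.mono' ?_ (Eventually.of_forall fun q => ?_)
    · apply Continuous.aestronglyMeasurable
      have hc : Continuous fun q : Mom d => ((‖(𝓕 (B : Mom d → ℂ)) (q - r)‖ ^ 2 : ℝ) : ℂ) := by
        have : Continuous fun q : Mom d => spectralDensity B (q - r) :=
          (spectralDensity B).continuous.comp (continuous_id.sub continuous_const)
        exact this.congr fun q => spectralDensity_apply B _
      refine hc.div ?_ h0
      unfold kin
      fun_prop
    · rw [norm_div, ← spectralDensity_apply, div_eq_mul_inv]
      gcongr
      refine le_trans ?_ (Complex.abs_im_le_norm _)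
      simp [abs_of_pos hε]
  rw [selfEnergyReg, ← Complex.imCLM_apply, ← ContinuousLinearMap.integral_comp_comm _ hint]
  refine integral_nonpos fun q => ?_
  simp only [Complex.imCLM_apply, Pi.zero_apply]
  rw [div_eq_mul_inv, Complex.im_ofReal_mul, Complex.inv_im]
  refine mul_nonpos_of_nonneg_of_nonpos (by positivity) ?_
  refine div_nonpos_of_nonpos_of_nonneg ?_ (normSq_nonneg _)
  simpa using hε.le

lemma sqrt_sub_sqrt_abs_le (u v : ℝ) : |√u - √v| ≤ √|u - v| := by
  wlog h : v ≤ u generalizing u v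
  · rw [abs_sub_comm, abs_sub_comm u v]
    exact this v u (le_of_not_ge h)
  rw [abs_of_nonneg (sub_nonneg.2 (Real.sqrt_le_sqrt h)), abs_of_nonneg (sub_nonneg.2 h)]
  rw [sub_le_iff_le_add]
  calc √u = √((u - v) + v) := by ring_nf
    _ ≤ _ := by
      rw [Real.sqrt_le_iff]
      refine ⟨by positivity, ?_⟩
      rcases le_total v 0 with hv | hv
      · rw [Real.sqrt_eq_zero_of_nonpos hv, add_zero, Real.sq_sqrt (by linarith)]
        linarith
      · nlinarith [Real.sq_sqrt hv, Real.sq_sqrt (sub_nonneg.2 h),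
          mul_nonneg (Real.sqrt_nonneg (u - v)) (Real.sqrt_nonneg v)]

/-- The self-energy extended constantly to negative energies: bounded, Hölder continuous of
exponent `1/2`, and with nonpositive imaginary part. -/
lemma selfEnergy_regularity {d : ℕ} (hd : 3 ≤ d) (B : 𝓢(Mom d, ℂ))
    (hB : ∀ x y : Mom d, ‖x‖ = ‖y‖ → B x = B y) :
    ∃ K : ℝ, 0 < K ∧ ∃ T : ℝ → ℂ, (∀ u, 0 ≤ u → selfEnergy B u = T u) ∧
      (∀ u, ‖T u‖ ≤ K) ∧ (∀ u v, ‖T u - T v‖ ≤ K * √|u - v|) ∧ ∀ u, (T u).im ≤ 0 := by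
  obtain ⟨C, hC, h⟩ := timeIntegral_bounds hd (spectralDensity B)
  have : NeZero d := ⟨by omega⟩
  -- Representatives of all energies are taken on one coordinate axis, so that momentum differences
  -- are also O(√|u-v|) and do not spoil the Hölder bound.
  set e : ℝ → Mom d := fun u => EuclideanSpace.single 0 (√(2 * max u 0)) with he
  have hkin : ∀ u, kin (e u) = max u 0 := by
    intro u
    simp only [kin, he, PiLp.norm_single, Real.norm_eq_abs, sq_abs]
    rw [Real.sq_sqrt (by positivity)]
    ring
  have hsub : ∀ u v, ‖e u - e v‖ ≤ 2 * √|u - v| := by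
    intro u v
    have h1 : e u - e v = EuclideanSpace.single 0 (√(2 * max u 0) - √(2 * max v 0)) := by
      simp only [he]
      ext i
      by_cases hi : i = 0 <;> simp [hi]
    rw [h1, PiLp.norm_single, Real.norm_eq_abs]
    refine (sqrt_sub_sqrt_abs_le _ _).trans ?_
    rw [← mul_sub, abs_mul, abs_of_pos (by norm_num : (0 : ℝ) < 2)]
    calc _ ≤ √(4 * |u - v|) := by
          apply Real.sqrt_le_sqrt
          have := abs_max_sub_max_le_abs u v 0
          have := abs_nonneg (u - v)
          linarith
      _ = _ := by
          rw [Real.sqrt_mul (by norm_num)]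
          congr 1
          rw [show (4 : ℝ) = 2 ^ 2 by norm_num]
          exact Real.sqrt_sq (by norm_num)
  refine ⟨3 * C + 1, by positivity, fun u => selfEnergy B (max u 0), ?_, ?_, ?_, ?_⟩
  · intro u hu
    simp [hu]
  · intro u
    beta_reduce
    rw [← hkin u, selfEnergy_kin hd B hB, norm_mul, norm_neg, norm_I, one_mul]
    have := (h (e u) (e u)).1
    linarith
  · intro u v
    beta_reduce
    rcases eq_or_lt_of_le (abs_nonneg (kin (e u) - kin (e v))) with h0 | h0
    · have : max u 0 = max v 0 := by
        rw [← hkin, ← hkin]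
        exact sub_eq_zero.1 (abs_eq_zero.1 h0.symm)
      rw [this, sub_self, norm_zero]
      positivity
    · rw [← hkin u, ← hkin v, selfEnergy_kin hd B hB, selfEnergy_kin hd B hB, ← mul_sub, norm_mul,
        norm_neg, norm_I, one_mul]
      refine ((h (e u) (e v)).2 h0).trans ?_
      have h2 : √|kin (e u) - kin (e v)| ≤ √|u - v| := by
        rw [hkin, hkin]
        exact Real.sqrt_le_sqrt (abs_max_sub_max_le_abs u v 0)
      have h3 := hsub u v
      calc _ ≤ C * (√|u - v| + 2 * √|u - v|) := by gcongr
        _ ≤ _ := by nlinarith [Real.sqrt_nonneg |u - v|]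
  · intro u
    beta_reduce
    have ht := tendsto_selfEnergyReg hd B (e u)
    rw [← selfEnergy_kin hd B hB, hkin] at ht
    refine le_of_tendsto ((Complex.continuous_im.tendsto _).comp ht) ?_
    filter_upwards [self_mem_nhdsWithin] with ε hε
    have := selfEnergyReg_im_nonpos B hε (e u)
    rwa [hkin] at this

/-! ### One-dimensional majorants for pairs of resolvents -/

/-- If `z` is nearly a translate of `u ↦ -u` and bounded below by `η`, then `|z|` is comparable to
`|u - u₀| + η` for some `u₀`. -/
lemma exists_center {s : Set ℝ} (hs : s.Nonempty) {z : ℝ → ℂ} {η : ℝ} (hη : 0 < η)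
    (hlow : ∀ u ∈ s, η ≤ ‖z u‖)
    (hlip : ∀ u ∈ s, ∀ v ∈ s, ‖z u - z v + ((u - v : ℝ) : ℂ)‖ ≤ |u - v| / 2 + η) :
    ∃ u₀, ∀ u ∈ s, |u - u₀| + η ≤ 9 * ‖z u‖ := by
  set S := (fun u => ‖z u‖) '' s with hS
  have hne : S.Nonempty := hs.image _
  have hbdd : BddBelow S := ⟨η, by rintro _ ⟨u, hu, rfl⟩; exact hlow u hu⟩
  have hm : η ≤ sInf S := le_csInf hne (by rintro _ ⟨u, hu, rfl⟩; exact hlow u hu)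
  -- The center is a point where |z| is within a factor 2 of its infimum, which need not be
  -- attained. Then |u-u₀|/2 ≤ 3|z u| + η, and with η ≤ |z u| the constant 9 results.
  obtain ⟨_, ⟨u₀, hu₀, rfl⟩, h0⟩ := exists_lt_of_csInf_lt hne (show sInf S < 2 * sInf S by linarith)
  refine ⟨u₀, fun u hu => ?_⟩
  have h1 : sInf S ≤ ‖z u‖ := csInf_le hbdd ⟨u, hu, rfl⟩
  have h2 : ‖((u - u₀ : ℝ) : ℂ)‖ ≤ ‖z u - z u₀ + ((u - u₀ : ℝ) : ℂ)‖ + (‖z u‖ + ‖z u₀‖) := by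
    calc _ = ‖(z u - z u₀ + ((u - u₀ : ℝ) : ℂ)) - (z u - z u₀)‖ := by congr 1; ring
      _ ≤ _ := (norm_sub_le _ _).trans (by gcongr; exact norm_sub_le _ _)
  rw [Complex.norm_real, Real.norm_eq_abs] at h2
  have h3 := hlip u hu u₀ hu₀
  have h4 := hlow u hu
  simp only at h0
  linarith

/-- The one-dimensional majorant `(|x| + η) ^ (-3/2)`. -/
def peak (η x : ℝ) : ℝ := (|x| + η) ^ (-3 / 2 : ℝ)

lemma peak_nonneg {η : ℝ} (hη : 0 < η) (x : ℝ) : 0 ≤ peak η x := by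
  unfold peak; positivity

lemma integrable_peak_one : Integrable (peak 1) := by
  have := integrable_one_add_norm (E := ℝ) (r := 3 / 2) (μ := volume) (by norm_num)
  refine this.congr (Eventually.of_forall fun x => ?_)
  simp only [peak, Real.norm_eq_abs]
  rw [add_comm]
  norm_num

lemma peak_eq {η : ℝ} (hη : 0 < η) (x : ℝ) : peak η x = η ^ (-3 / 2 : ℝ) * peak 1 (x / η) := by
  unfold peak
  rw [← Real.mul_rpow hη.le (by positivity), abs_div, abs_of_pos hη]
  congr 1
  field_simp

lemma integral_peak {η : ℝ} (hη : 0 < η) (c : ℝ) :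
    Integrable (fun u => peak η (u - c)) ∧ ∫ u, peak η (u - c) = (∫ u, peak 1 u) / √η := by
  have h : peak η = fun x => η ^ (-3 / 2 : ℝ) * peak 1 (x / η) := funext (peak_eq hη)
  constructor
  · have : Integrable (peak η) := by
      rw [h]
      exact (integrable_peak_one.comp_div hη.ne').const_mul _
    exact this.comp_sub_right c
  · rw [integral_sub_right_eq_self (peak η) c, h, integral_const_mul,
      Measure.integral_comp_div (peak 1) η, smul_eq_mul, abs_of_pos hη, ← mul_assoc]
    have : η ^ (-3 / 2 : ℝ) * η = (√η)⁻¹ := by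
      rw [← Real.rpow_add_one hη.ne', Real.sqrt_eq_rpow, ← Real.rpow_neg hη.le]
      norm_num
    rw [this]
    ring

/-- The left side is 1/(√X · Y), which only grows when both factors are evaluated at the smaller of
X and Y. -/
lemma sqrt_div_mul_le {X Y : ℝ} (hX : 0 < X) (hY : 0 < Y) :
    √X / (X * Y) ≤ X ^ (-3 / 2 : ℝ) + Y ^ (-3 / 2 : ℝ) := by
  have e : ∀ {W : ℝ}, 0 < W → W ^ (-3 / 2 : ℝ) = 1 / (√W * W) := by
    intro W hW
    rw [Real.sqrt_eq_rpow, ← Real.rpow_add_one hW.ne', one_div, ← Real.rpow_neg hW.le]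
    norm_num
  have e1 : √X / (X * Y) = 1 / (√X * Y) := by
    have := Real.mul_self_sqrt hX.le
    have h0 := Real.sqrt_pos.2 hX
    rw [div_eq_div_iff (by positivity) (by positivity)]
    linear_combination Y * this
  rw [e1, e hX, e hY]
  have hx := Real.sqrt_pos.2 hX
  have hy := Real.sqrt_pos.2 hY
  rcases le_total X Y with h | h
  · have : 1 / (√X * Y) ≤ 1 / (√X * X) := by gcongr
    have : 0 ≤ 1 / (√Y * Y) := by positivity
    linarith
  · have : 1 / (√X * Y) ≤ 1 / (√Y * Y) := by gcongr
    have : 0 ≤ 1 / (√X * X) := by positivity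
    linarith

lemma rpow_le_peak {X η x : ℝ} (hη : 0 < η) (h : |x| + η ≤ 9 * X) :
    X ^ (-3 / 2 : ℝ) ≤ 27 * peak η x := by
  have hX : 0 < X := by have := abs_nonneg x; linarith
  have h9 : (9 : ℝ) ^ (-3 / 2 : ℝ) = 1 / 27 := by
    rw [show (9 : ℝ) = 3 ^ (2 : ℝ) by norm_num, ← Real.rpow_mul (by norm_num),
      show (2 : ℝ) * (-3 / 2) = ((-3 : ℤ) : ℝ) by norm_num, Real.rpow_intCast]
    norm_num
  have h1 : (9 * X) ^ (-3 / 2 : ℝ) ≤ peak η x :=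
    Real.rpow_le_rpow_of_nonpos (by positivity) h (by norm_num)
  rw [Real.mul_rpow (by norm_num) hX.le, h9] at h1
  linarith

/-- The gap bound `hγ` gives √|u-γ| ≤ √X + √Y + √K λ, and λ ≤ (λ/√η) · 3√X because √η ≤ 3√X. The
numerator is thus O(λ/√η)(√X + √Y), and each half power cancels against the denominator. -/
lemma pair_majorant {η lam K X Y u γ x₀ y₀ : ℝ} (hη : 0 < η) (hlam : 0 < lam)
    (hηl : η ≤ lam ^ 2) (hX : |u - x₀| + η ≤ 9 * X) (hY : |u - y₀| + η ≤ 9 * Y)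
    (hK : 0 ≤ K) (hγ : |u - γ| ≤ X + Y + K * lam ^ 2) :
    (√|u - γ| + lam) / (X * Y) ≤
      54 * (4 + 3 * √K) * (lam / √η) * (peak η (u - x₀) + peak η (u - y₀)) := by
  have hX0 : 0 < X := by have := abs_nonneg (u - x₀); linarith
  have hY0 : 0 < Y := by have := abs_nonneg (u - y₀); linarith
  have hs : 0 < √η := Real.sqrt_pos.2 hη
  have hsl : √η ≤ lam := by
    rw [Real.sqrt_le_iff]
    exact ⟨hlam.le, hηl⟩
  have hq : 1 ≤ lam / √η := (one_le_div hs).2 hsl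
  have hl : lam ≤ lam / √η * (3 * √X) := by
    have : √η ≤ 3 * √X := by
      rw [Real.sqrt_le_iff]
      refine ⟨by positivity, ?_⟩
      rw [mul_pow, Real.sq_sqrt hX0.le]
      have := abs_nonneg (u - x₀)
      linarith
    calc lam = lam / √η * √η := by field_simp
      _ ≤ _ := by gcongr
  have hsum : √|u - γ| ≤ √X + √Y + √K * lam := by
    rw [Real.sqrt_le_iff]
    refine ⟨by positivity, hγ.trans ?_⟩
    have h1 := Real.sq_sqrt hX0.le
    have h2 := Real.sq_sqrt hY0.le
    have h3 := Real.sq_sqrt hK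
    have p1 : 0 ≤ √X * √Y := by positivity
    have p2 : 0 ≤ √X * (√K * lam) := by positivity
    have p3 : 0 ≤ √Y * (√K * lam) := by positivity
    have h4 : (√K * lam) ^ 2 = K * lam ^ 2 := by rw [mul_pow, h3]
    nlinarith
  have hnum : √|u - γ| + lam ≤ (4 + 3 * √K) * (lam / √η) * (√X + √Y) := by
    have a1 : √X + √Y ≤ lam / √η * (√X + √Y) := le_mul_of_one_le_left (by positivity) hq
    have a2 : (√K + 1) * lam ≤ (√K + 1) * (lam / √η * (3 * √X)) := by gcongr
    have a3 : 0 ≤ (√K + 1) * (lam / √η * (3 * √Y)) := by positivity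
    calc _ ≤ (√X + √Y) + (√K + 1) * lam := by linarith
      _ ≤ lam / √η * (√X + √Y) + (√K + 1) * (lam / √η * (3 * √X))
          + (√K + 1) * (lam / √η * (3 * √Y)) := by linarith
      _ = _ := by ring
  have b1 := sqrt_div_mul_le hX0 hY0
  have b2 := sqrt_div_mul_le hY0 hX0
  have c1 := rpow_le_peak hη hX
  have c2 := rpow_le_peak hη hY
  calc _ ≤ (4 + 3 * √K) * (lam / √η) * (√X + √Y) / (X * Y) := by gcongr
    _ = (4 + 3 * √K) * (lam / √η) * (√X / (X * Y) + √Y / (Y * X)) := by ring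
    _ ≤ (4 + 3 * √K) * (lam / √η) * (54 * (peak η (u - x₀) + peak η (u - y₀))) := by
        gcongr
        linarith
    _ = _ := by ring

/-- The constant in the estimate of integrals of products of two resolvents. -/
def pairConst (K : ℝ) : ℝ := 108 * (4 + 3 * √K) * ∫ u, peak 1 u

lemma pairConst_nonneg (K : ℝ) : 0 ≤ pairConst K := by
  have : 0 ≤ ∫ u, peak 1 u := integral_nonneg fun u => peak_nonneg one_pos u
  unfold pairConst
  positivity

/-- Each peak contributes 1/√η, turning λ/√η into λ/η. The centers are arbitrary, so the bound is
uniform in the energies. -/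
lemma pair_integral_le {s : Set ℝ} (hs : MeasurableSet s) {η lam K γ x₀ y₀ c : ℝ} {X Y h : ℝ → ℂ}
    (hη : 0 < η) (hlam : 0 < lam) (hηl : η ≤ lam ^ 2)
    (hX : ∀ u ∈ s, |u - x₀| + η ≤ 9 * ‖X u‖) (hY : ∀ u ∈ s, |u - y₀| + η ≤ 9 * ‖Y u‖)
    (hK : 0 ≤ K) (hγ : ∀ u ∈ s, |u - γ| ≤ ‖X u‖ + ‖Y u‖ + K * lam ^ 2) (hc : 0 ≤ c)
    (hh : ∀ u ∈ s, ‖h u‖ ≤ c * ((√|u - γ| + lam) / (‖X u‖ * ‖Y u‖))) :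
    (AEStronglyMeasurable h (volume.restrict s) → IntegrableOn h s) ∧
      ‖∫ u in s, h u‖ ≤ c * pairConst K * (lam / η) := by
  obtain ⟨i1, e1⟩ := integral_peak hη x₀
  obtain ⟨i2, e2⟩ := integral_peak hη y₀
  set D := c * (54 * (4 + 3 * √K) * (lam / √η)) with hD
  have hD0 : 0 ≤ D := by positivity
  have hi : Integrable fun u => D * (peak η (u - x₀) + peak η (u - y₀)) := (i1.add i2).const_mul D
  have hb : ∀ᵐ u ∂(volume.restrict s), ‖h u‖ ≤ D * (peak η (u - x₀) + peak η (u - y₀)) := by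
    filter_upwards [ae_restrict_mem hs] with u hu
    refine (hh u hu).trans ?_
    rw [hD, mul_assoc]
    exact mul_le_mul_of_nonneg_left (pair_majorant hη hlam hηl (hX u hu) (hY u hu) hK (hγ u hu)) hc
  refine ⟨fun hm => hi.integrableOn.mono' hm hb, ?_⟩
  calc _ ≤ ∫ u in s, D * (peak η (u - x₀) + peak η (u - y₀)) :=
        norm_integral_le_of_norm_le hi.integrableOn hb
    _ ≤ ∫ u, D * (peak η (u - x₀) + peak η (u - y₀)) :=
        setIntegral_le_integral hi (Eventually.of_forall fun u =>
          mul_nonneg hD0 (add_nonneg (peak_nonneg hη _) (peak_nonneg hη _)))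
    _ = _ := by
        rw [integral_const_mul, integral_add i1 i2, e1, e2, hD, pairConst]
        have := Real.mul_self_sqrt hη.le
        have h0 := Real.sqrt_pos.2 hη
        nth_rewrite 4 [← this]
        field_simp
        ring

/-! ### Exact integral of a pair with constant coefficients -/

lemma norm_sub_I_ge (a u η : ℝ) (hη : 0 < η) :
    |u - a| + η ≤ 9 * ‖(a : ℂ) - u - I * η‖ ∧ |u - a| + η ≤ 9 * ‖(a : ℂ) - u + I * η‖ := by
  have h1 := Complex.abs_re_le_norm ((a : ℂ) - u - I * η)
  have h2 := Complex.abs_im_le_norm ((a : ℂ) - u - I * η)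
  have h3 := Complex.abs_re_le_norm ((a : ℂ) - u + I * η)
  have h4 := Complex.abs_im_le_norm ((a : ℂ) - u + I * η)
  simp [abs_of_pos hη] at h1 h2 h3 h4
  rw [abs_sub_comm] at h1 h3
  constructor <;> linarith [abs_nonneg (u - a)]

/-- After the positive factor u is split off, the arguments tend to -1 from below and from above the
branch cut. The logarithms tend to -πi and πi, and the terms log u cancel. -/
lemma tendsto_log_sub_log_atTop (a b : ℝ) {η : ℝ} (hη : 0 < η) :
    Tendsto (fun u : ℝ => Complex.log ((a : ℂ) - u - I * η) - Complex.log ((b : ℂ) - u + I * η))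
      atTop (𝓝 (-2 * Real.pi * I)) := by
  have hinv : Tendsto (fun u : ℝ => ((u⁻¹ : ℝ) : ℂ)) atTop (𝓝 0) := by
    have := (Complex.continuous_ofReal.tendsto 0).comp (tendsto_inv_atTop_zero (𝕜 := ℝ))
    simpa [Function.comp_def] using this
  have hz : ∀ c : ℂ, Tendsto (fun u : ℝ => c * ((u⁻¹ : ℝ) : ℂ) - 1) atTop (𝓝 (-1)) := by
    intro c
    simpa using (hinv.const_mul c).sub_const 1
  have h1 : Tendsto (fun u : ℝ => Complex.log (((a : ℂ) - I * η) * ((u⁻¹ : ℝ) : ℂ) - 1)) atTop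
      (𝓝 (-(Real.pi * I))) := by
    have h := Complex.tendsto_log_nhdsWithin_im_neg_of_re_neg_of_im_zero (z := -1)
      (by simp) (by simp)
    simp at h
    refine h.comp (tendsto_nhdsWithin_iff.2 ⟨hz _, ?_⟩)
    filter_upwards [eventually_gt_atTop 0] with u hu
    simp only [Complex.sub_im, Complex.mul_im]
    simp
    positivity
  have h2 : Tendsto (fun u : ℝ => Complex.log (((b : ℂ) + I * η) * ((u⁻¹ : ℝ) : ℂ) - 1)) atTop
      (𝓝 (Real.pi * I)) := by
    have h := Complex.tendsto_log_nhdsWithin_im_nonneg_of_re_neg_of_im_zero (z := -1)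
      (by simp) (by simp)
    simp at h
    refine h.comp (tendsto_nhdsWithin_iff.2 ⟨hz _, ?_⟩)
    filter_upwards [eventually_gt_atTop 0] with u hu
    simp only [Complex.sub_im, Complex.mul_im]
    simp
    positivity
  have h3 := h1.sub h2
  have e : -(Real.pi * I) - Real.pi * I = -2 * Real.pi * I := by ring
  rw [e] at h3
  refine h3.congr' ?_
  filter_upwards [eventually_gt_atTop 0] with u hu
  have hu' : (u : ℂ) ≠ 0 := by exact_mod_cast hu.ne'
  have key : ∀ c : ℂ, c - u ≠ 0 → Complex.log (c - u) =
      Real.log u + Complex.log (c * ((u⁻¹ : ℝ) : ℂ) - 1) := by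
    intro c hc
    have : c - u = u * (c * ((u⁻¹ : ℝ) : ℂ) - 1) := by
      push_cast
      field_simp
    have h0 : c * ((u⁻¹ : ℝ) : ℂ) - 1 ≠ 0 := by
      intro h
      rw [h, mul_zero] at this
      exact hc this
    rw [this, Complex.log_ofReal_mul hu h0]
  have k1 := key ((a : ℂ) - I * η) (by
    intro h
    have := congrArg Complex.im h
    simp at this
    exact hη.ne' this)
  have k2 := key ((b : ℂ) + I * η) (by
    intro h
    have := congrArg Complex.im h
    simp at this
    exact hη.ne' this)
  have r1 : (a : ℂ) - u - I * η = (a : ℂ) - I * η - u := by ring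
  have r2 : (b : ℂ) - u + I * η = (b : ℂ) + I * η - u := by ring
  rw [r1, r2, k1, k2]
  ring

lemma tendsto_log_sub_log_atBot (a b : ℝ) {η : ℝ} (hη : 0 < η) :
    Tendsto (fun u : ℝ => Complex.log ((a : ℂ) - u - I * η) - Complex.log ((b : ℂ) - u + I * η))
      atBot (𝓝 0) := by
  have hinv : Tendsto (fun u : ℝ => (((-u)⁻¹ : ℝ) : ℂ)) atBot (𝓝 0) := by
    have := (Complex.continuous_ofReal.tendsto 0).comp
      ((tendsto_inv_atTop_zero (𝕜 := ℝ)).comp tendsto_neg_atBot_atTop)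
    simpa [Function.comp_def] using this
  have hz : ∀ c : ℂ, Tendsto (fun u : ℝ => Complex.log (c * (((-u)⁻¹ : ℝ) : ℂ) + 1)) atBot
      (𝓝 0) := by
    intro c
    have h : Tendsto (fun u : ℝ => c * (((-u)⁻¹ : ℝ) : ℂ) + 1) atBot (𝓝 1) := by
      simpa using (hinv.const_mul c).add_const 1
    have := (continuousAt_clog Complex.one_mem_slitPlane).tendsto.comp h
    simpa [Function.comp_def] using this
  have h3 := (hz ((a : ℂ) - I * η)).sub (hz ((b : ℂ) + I * η))
  rw [sub_zero] at h3
  refine h3.congr' ?_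
  filter_upwards [eventually_lt_atBot 0] with u hu
  have hu0 : 0 < -u := by linarith
  have hu' : (u : ℂ) ≠ 0 := by exact_mod_cast hu.ne
  have key : ∀ c : ℂ, c - u ≠ 0 → Complex.log (c - u) =
      Real.log (-u) + Complex.log (c * (((-u)⁻¹ : ℝ) : ℂ) + 1) := by
    intro c hc
    have : c - u = (-u : ℝ) * (c * (((-u)⁻¹ : ℝ) : ℂ) + 1) := by
      push_cast
      field_simp
      ring
    have h0 : c * (((-u)⁻¹ : ℝ) : ℂ) + 1 ≠ 0 := by
      intro h
      rw [h, mul_zero] at this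
      exact hc this
    rw [this, Complex.log_ofReal_mul hu0 h0]
  have k1 := key ((a : ℂ) - I * η) (by
    intro h
    have := congrArg Complex.im h
    simp at this
    exact hη.ne' this)
  have k2 := key ((b : ℂ) + I * η) (by
    intro h
    have := congrArg Complex.im h
    simp at this
    exact hη.ne' this)
  have r1 : (a : ℂ) - u - I * η = (a : ℂ) - I * η - u := by ring
  have r2 : (b : ℂ) - u + I * η = (b : ℂ) + I * η - u := by ring
  rw [r1, r2, k1, k2]
  ring

/-- Partial fractions give a difference of logarithms as primitive. Neither argument meets the cut,
since the imaginary parts keep the signs -η and +η, so the integral is read off from the limits at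
±∞. -/
lemma integral_resolvent_pair (a b : ℝ) {η : ℝ} (hη : 0 < η) :
    Integrable (fun u : ℝ => 1 / (((a : ℂ) - u - I * η) * ((b : ℂ) - u + I * η))) ∧
    ∫ u : ℝ, 1 / (((a : ℂ) - u - I * η) * ((b : ℂ) - u + I * η)) =
      -2 * Real.pi * I / ((a : ℂ) - b - 2 * I * η) := by
  have hX : ∀ u : ℝ, (a : ℂ) - u - I * η ∈ slitPlane := fun u => by
    rw [Complex.mem_slitPlane_iff]; right; simp [hη.ne']
  have hY : ∀ u : ℝ, (b : ℂ) - u + I * η ∈ slitPlane := fun u => by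
    rw [Complex.mem_slitPlane_iff]; right; simp [hη.ne']
  have hX0 : ∀ u : ℝ, (a : ℂ) - u - I * η ≠ 0 := fun u => slitPlane_ne_zero (hX u)
  have hY0 : ∀ u : ℝ, (b : ℂ) - u + I * η ≠ 0 := fun u => slitPlane_ne_zero (hY u)
  have hD0 : (a : ℂ) - b - 2 * I * η ≠ 0 := by
    intro h
    have := congrArg Complex.im h
    simp at this
    exact hη.ne' this
  have hs := Real.sqrt_pos.2 hη
  have hint : Integrable (fun u : ℝ => 1 / (((a : ℂ) - u - I * η) * ((b : ℂ) - u + I * η))) := by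
    rw [← integrableOn_univ]
    -- With λ = √η and c = 1/√η the admissible numerator is at least 1, so the general pair bound
    -- already yields integrability.
    refine (pair_integral_le (K := 0) (γ := (a + b) / 2) (x₀ := a) (y₀ := b) (c := 1 / √η)
      (lam := √η) (X := fun u : ℝ => (a : ℂ) - u - I * η) (Y := fun u : ℝ => (b : ℂ) - u + I * η)
      MeasurableSet.univ hη hs (Real.sq_sqrt hη.le).ge
      (fun u _ => (norm_sub_I_ge a u η hη).1) (fun u _ => (norm_sub_I_ge b u η hη).2) le_rfl
      (fun u _ => ?_) (by positivity) (fun u _ => ?_)).1 ?_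
    · have h1 := Complex.abs_re_le_norm ((a : ℂ) - u - I * η)
      have h2 := Complex.abs_re_le_norm ((b : ℂ) - u + I * η)
      simp at h1 h2
      have h3 : |u - (a + b) / 2| ≤ (|a - u| + |b - u|) / 2 := by
        rw [le_div_iff₀ (by norm_num), ← abs_of_pos (show (0 : ℝ) < 2 by norm_num), ← abs_mul,
          abs_of_pos (show (0 : ℝ) < 2 by norm_num), abs_sub_comm a, abs_sub_comm b]
        refine le_trans (le_of_eq ?_) (abs_add_le _ _)
        congr 1; ring
      have := abs_nonneg (a - u)
      have := abs_nonneg (b - u)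
      linarith
    · have p1 := norm_pos_iff.2 (hX0 u)
      have p2 := norm_pos_iff.2 (hY0 u)
      rw [norm_div, norm_one, norm_mul, ← mul_div_assoc]
      gcongr
      rw [mul_add, one_div, inv_mul_cancel₀ hs.ne']
      have : 0 ≤ (√η)⁻¹ * √|u - (a + b) / 2| := by positivity
      linarith
    · apply Continuous.aestronglyMeasurable
      refine continuous_const.div (by fun_prop) fun u => mul_ne_zero (hX0 u) (hY0 u)
  refine ⟨hint, ?_⟩
  set F : ℝ → ℂ := fun u => (Complex.log ((a : ℂ) - u - I * η) -
    Complex.log ((b : ℂ) - u + I * η)) / ((a : ℂ) - b - 2 * I * η) with hF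
  have hder : ∀ u : ℝ, HasDerivAt F
      (1 / (((a : ℂ) - u - I * η) * ((b : ℂ) - u + I * η))) u := by
    intro u
    have hu : HasDerivAt (fun u : ℝ => (u : ℂ)) 1 u := Complex.ofRealCLM.hasDerivAt
    have d1 : HasDerivAt (fun u : ℝ => (a : ℂ) - u - I * η) (-1) u := by
      simpa using (hu.const_sub (a : ℂ)).sub_const (I * η)
    have d2 : HasDerivAt (fun u : ℝ => (b : ℂ) - u + I * η) (-1) u := by
      simpa using (hu.const_sub (b : ℂ)).add_const (I * η)
    have d3 := ((d1.clog_real (hX u)).sub (d2.clog_real (hY u))).div_const ((a : ℂ) - b - 2 * I * η)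
    refine d3.congr_deriv ?_
    rw [div_sub_div _ _ (hX0 u) (hY0 u), div_div, div_eq_div_iff
      (mul_ne_zero (mul_ne_zero (hX0 u) (hY0 u)) hD0) (mul_ne_zero (hX0 u) (hY0 u))]
    ring
  have ht := (tendsto_log_sub_log_atTop a b hη).div_const ((a : ℂ) - b - 2 * I * η)
  have hb := (tendsto_log_sub_log_atBot a b hη).div_const ((a : ℂ) - b - 2 * I * η)
  rw [integral_of_hasDerivAt_of_tendsto hder hint hb ht]
  simp

/-! ### Symbols along a ray and their frozen versions -/

lemma continuous_of_sqrt_modulus {T : ℝ → ℂ} {K : ℝ}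
    (hT : ∀ u v, ‖T u - T v‖ ≤ K * √|u - v|) : Continuous T := by
  rw [continuous_iff_continuousAt]
  intro v
  rw [ContinuousAt, tendsto_iff_norm_sub_tendsto_zero]
  have : Continuous fun u : ℝ => K * √|u - v| := by fun_prop
  have h := this.tendsto v
  simp only [sub_self, abs_zero, Real.sqrt_zero, mul_zero] at h
  exact squeeze_zero (fun _ => norm_nonneg _) (fun u => hT u v) h

/-- The energy shifted by the momentum transfer, along a ray. -/
def shiftedEnergy (y R u : ℝ) : ℝ := u + √(2 * u) * y + R

/-- The inverse resolvent along a ray, with complex self-energy `T`. -/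
def raySymbol (T : ℝ → ℂ) (lam η b y R u : ℝ) : ℂ :=
  (b : ℂ) - shiftedEnergy y R u - (lam : ℂ) ^ 2 * T (shiftedEnergy y R u) + I * η

/-- The inverse resolvent along a ray with coefficients frozen at the energy `γ`. -/
def frozenSymbol (T : ℝ → ℂ) (lam η b y γ u : ℝ) : ℂ :=
  (b : ℂ) - u - √(2 * γ) * y - (lam : ℂ) ^ 2 * T γ + I * η

section Symbols

variable {T : ℝ → ℂ} {K lam η b y R : ℝ}

lemma re_sq_mul (lam : ℝ) (z : ℂ) : ((lam : ℂ) ^ 2 * z).re = lam ^ 2 * z.re := by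
  rw [← ofReal_pow, Complex.re_ofReal_mul]

lemma im_sq_mul (lam : ℝ) (z : ℂ) : ((lam : ℂ) ^ 2 * z).im = lam ^ 2 * z.im := by
  rw [← ofReal_pow, Complex.im_ofReal_mul]

lemma raySymbol_re (u : ℝ) : (raySymbol T lam η b y R u).re =
    b - shiftedEnergy y R u - lam ^ 2 * (T (shiftedEnergy y R u)).re := by
  simp only [raySymbol, Complex.add_re, Complex.sub_re, re_sq_mul]
  simp

lemma raySymbol_im (u : ℝ) : (raySymbol T lam η b y R u).im =
    η - lam ^ 2 * (T (shiftedEnergy y R u)).im := by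
  simp only [raySymbol, Complex.add_im, Complex.sub_im, im_sq_mul]
  simp
  ring

lemma frozenSymbol_re (γ u : ℝ) : (frozenSymbol T lam η b y γ u).re =
    b - u - √(2 * γ) * y - lam ^ 2 * (T γ).re := by
  simp only [frozenSymbol, Complex.add_re, Complex.sub_re, re_sq_mul]
  simp

lemma frozenSymbol_im (γ u : ℝ) : (frozenSymbol T lam η b y γ u).im =
    η - lam ^ 2 * (T γ).im := by
  simp only [frozenSymbol, Complex.add_im, Complex.sub_im, im_sq_mul]
  simp
  ring

lemma le_norm_raySymbol (hT : ∀ u, (T u).im ≤ 0) (u : ℝ) : η ≤ ‖raySymbol T lam η b y R u‖ := by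
  refine le_trans ?_ ((le_abs_self _).trans (Complex.abs_im_le_norm _))
  rw [raySymbol_im]
  nlinarith [mul_nonneg (sq_nonneg lam) (neg_nonneg.2 (hT (shiftedEnergy y R u)))]

lemma le_norm_frozenSymbol (hT : ∀ u, (T u).im ≤ 0) (γ u : ℝ) :
    η ≤ ‖frozenSymbol T lam η b y γ u‖ := by
  refine le_trans ?_ ((le_abs_self _).trans (Complex.abs_im_le_norm _))
  rw [frozenSymbol_im]
  nlinarith [mul_nonneg (sq_nonneg lam) (neg_nonneg.2 (hT γ))]

lemma continuous_raySymbol (hT : Continuous T) : Continuous (raySymbol T lam η b y R) := by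
  unfold raySymbol shiftedEnergy
  fun_prop

lemma continuous_frozenSymbol (γ : ℝ) : Continuous (frozenSymbol T lam η b y γ) := by
  unfold frozenSymbol
  fun_prop

lemma abs_sqrt_two_mul_sub_le (u v : ℝ) : |√(2 * u) - √(2 * v)| ≤ 2 * √|u - v| := by
  refine (sqrt_sub_sqrt_abs_le _ _).trans ?_
  rw [← mul_sub, abs_mul, abs_of_pos (by norm_num : (0 : ℝ) < 2), Real.sqrt_mul (by norm_num)]
  gcongr
  rw [Real.sqrt_le_iff]
  norm_num

lemma sqrt_add_le_add (a b : ℝ) (ha : 0 ≤ a) (hb : 0 ≤ b) : √(a + b) ≤ √a + √b := by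
  rw [Real.sqrt_le_iff]
  refine ⟨by positivity, ?_⟩
  nlinarith [Real.sq_sqrt ha, Real.sq_sqrt hb, mul_nonneg (Real.sqrt_nonneg a) (Real.sqrt_nonneg b)]

/-- The departure from u ↦ -u is Hölder-1/2 with constant O(λ²). By the arithmetic-geometric mean
inequality λ²√D is at most a small multiple of D plus O(λ⁴), and `hη` lets η absorb the latter. This
is the input of `exists_center`. -/
lemma raySymbol_sub_le (hT : ∀ u v, ‖T u - T v‖ ≤ K * √|u - v|)
    (hy : |y| ≤ lam ^ 2) (hη : (9 + 4 * K ^ 2) * lam ^ 4 ≤ η) (u v : ℝ) :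
    ‖raySymbol T lam η b y R u - raySymbol T lam η b y R v + ((u - v : ℝ) : ℂ)‖
      ≤ |u - v| / 2 + η := by
  set D := |u - v| with hD
  have hD0 : 0 ≤ D := abs_nonneg _
  set x := shiftedEnergy y R u - shiftedEnergy y R v with hx
  have hx1 : x = (u - v) + (√(2 * u) - √(2 * v)) * y := by
    simp only [hx, shiftedEnergy]; ring
  have h1 : |(√(2 * u) - √(2 * v)) * y| ≤ D / 8 + 8 * lam ^ 4 := by
    rw [abs_mul]
    calc _ ≤ 2 * √D * lam ^ 2 := by
          gcongr
          exact abs_sqrt_two_mul_sub_le u v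
      _ ≤ _ := by nlinarith [Real.sq_sqrt hD0, sq_nonneg (√D - 8 * lam ^ 2)]
  have h2 : |x| ≤ D + (D / 8 + 8 * lam ^ 4) := by
    rw [hx1]
    exact (abs_add_le _ _).trans (by gcongr)
  have h3 : lam ^ 2 * (K * √|x|) ≤ |x| / 16 + 4 * K ^ 2 * lam ^ 4 := by
    nlinarith [Real.sq_sqrt (abs_nonneg x), sq_nonneg (√|x| - 8 * (K * lam ^ 2))]
  have e : raySymbol T lam η b y R u - raySymbol T lam η b y R v + ((u - v : ℝ) : ℂ) =
      -(((√(2 * u) - √(2 * v)) * y : ℝ) : ℂ) -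
        (lam : ℂ) ^ 2 * (T (shiftedEnergy y R u) - T (shiftedEnergy y R v)) := by
    simp only [raySymbol]
    have : ((√(2 * u) - √(2 * v)) * y : ℝ) = shiftedEnergy y R u - shiftedEnergy y R v - (u - v) := by
      rw [← hx, hx1]; ring
    rw [this]
    push_cast
    ring
  rw [e]
  refine (norm_sub_le _ _).trans ?_
  rw [norm_neg, Complex.norm_real, Real.norm_eq_abs, norm_mul, norm_pow, Complex.norm_real,
    Real.norm_eq_abs, sq_abs]
  have h4 : lam ^ 2 * ‖T (shiftedEnergy y R u) - T (shiftedEnergy y R v)‖ ≤ lam ^ 2 * (K * √|x|) := by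
    gcongr
    exact hT _ _
  have : 0 ≤ lam ^ 4 := by positivity
  linarith

lemma frozenSymbol_sub (γ u v : ℝ) :
    frozenSymbol T lam η b y γ u - frozenSymbol T lam η b y γ v + ((u - v : ℝ) : ℂ) = 0 := by
  simp only [frozenSymbol]
  push_cast
  ring

/-- The energy shift √(2u) y + R is O(λ²(1 + √(2u))), so the Hölder bound on T produces √|u-γ| plus
O(λ(1 + √(2u))). The growth in √(2u) is later paid for by the decay of f. -/
lemma raySymbol_sub_frozenSymbol_le (hK : 0 ≤ K) (hT : ∀ u v, ‖T u - T v‖ ≤ K * √|u - v|)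
    (hlam : 0 < lam) (hlam1 : lam ≤ 1)
    (hy : |y| ≤ lam ^ 2) (hR : 0 ≤ R) (hR2 : R ≤ lam ^ 4) (γ u : ℝ) :
    ‖raySymbol T lam η b y R u - frozenSymbol T lam η b y γ u‖ ≤
      (2 + 2 * K) * lam ^ 2 * (√|u - γ| + lam) * (1 + √(2 * u)) := by
  set ρ := √(2 * u) with hρ
  have hρ0 : 0 ≤ ρ := Real.sqrt_nonneg _
  set S := √|u - γ| with hS
  have hS0 : 0 ≤ S := Real.sqrt_nonneg _
  have h1 : |(ρ - √(2 * γ)) * y| ≤ 2 * S * lam ^ 2 := by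
    rw [abs_mul]
    gcongr
    exact abs_sqrt_two_mul_sub_le u γ
  have h2 : |shiftedEnergy y R u - γ| ≤ |u - γ| + (lam ^ 2 * ρ + lam ^ 4) := by
    have : shiftedEnergy y R u - γ = (u - γ) + (y * ρ + R) := by
      simp only [shiftedEnergy]; ring
    rw [this]
    refine (abs_add_le _ _).trans ?_
    gcongr
    refine (abs_add_le _ _).trans ?_
    rw [abs_mul, abs_of_nonneg hρ0, abs_of_nonneg hR]
    gcongr
  have h3 : √|shiftedEnergy y R u - γ| ≤ S + 2 * lam * (1 + ρ) := by
    calc _ ≤ √(|u - γ| + (lam ^ 2 * ρ + lam ^ 4)) := Real.sqrt_le_sqrt h2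
      _ ≤ S + √(lam ^ 2 * ρ + lam ^ 4) := sqrt_add_le_add _ _ (abs_nonneg _) (by positivity)
      _ ≤ _ := by
        gcongr
        rw [Real.sqrt_le_iff]
        refine ⟨by positivity, ?_⟩
        have : lam ^ 4 ≤ lam ^ 2 := pow_le_pow_of_le_one hlam.le hlam1 (by norm_num)
        have h0 : 0 ≤ lam ^ 2 := by positivity
        nlinarith [mul_nonneg h0 hρ0, mul_nonneg h0 (sq_nonneg ρ)]
  have e : raySymbol T lam η b y R u - frozenSymbol T lam η b y γ u =
      -(((ρ - √(2 * γ)) * y + R : ℝ) : ℂ) - (lam : ℂ) ^ 2 * (T (shiftedEnergy y R u) - T γ) := by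
    have : (((ρ - √(2 * γ)) * y + R : ℝ) : ℂ) =
        ((shiftedEnergy y R u - u - √(2 * γ) * y : ℝ) : ℂ) := by
      congr 1
      simp only [shiftedEnergy]; ring
    rw [this]
    simp only [raySymbol, frozenSymbol]
    push_cast
    ring
  rw [e]
  refine (norm_sub_le _ _).trans ?_
  rw [norm_neg, Complex.norm_real, Real.norm_eq_abs, norm_mul, norm_pow, Complex.norm_real,
    Real.norm_eq_abs, sq_abs]
  have h4 : ‖T (shiftedEnergy y R u) - T γ‖ ≤ K * (S + 2 * lam * (1 + ρ)) :=
    (hT _ _).trans (by gcongr)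
  have h5 : |(ρ - √(2 * γ)) * y + R| ≤ 2 * S * lam ^ 2 + lam ^ 4 := by
    refine (abs_add_le _ _).trans ?_
    rw [abs_of_nonneg hR]
    gcongr
  have h6 : lam ^ 4 ≤ lam ^ 2 * lam := by
    rw [← pow_succ]
    exact pow_le_pow_of_le_one hlam.le hlam1 (by norm_num)
  have p1 : 0 ≤ lam ^ 2 * lam := by positivity
  have p2 : 0 ≤ lam ^ 2 * S := by positivity
  have p3 : 0 ≤ lam ^ 2 * S * ρ := by positivity
  have p4 : 0 ≤ lam ^ 2 * lam * ρ := by positivity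
  have p5 : 0 ≤ K * (lam ^ 2 * S) := by positivity
  have p6 : 0 ≤ K * (lam ^ 2 * S * ρ) := by positivity
  calc _ ≤ 2 * S * lam ^ 2 + lam ^ 4 + lam ^ 2 * (K * (S + 2 * lam * (1 + ρ))) := by gcongr
    _ ≤ _ := by nlinarith

/-- In the sum of the two real parts the terms ±√(2u) y cancel, leaving α + β - 2u up to R and the
bounded self-energies. This is why γ must be the midpoint. -/
lemma abs_sub_le_raySymbol_pair (hTb : ∀ u, ‖T u‖ ≤ K) {α β : ℝ} (hlam : 0 < lam) (hlam1 : lam ≤ 1)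
    (hR : 0 ≤ R) (hR2 : R ≤ lam ^ 4) (u : ℝ) :
    |u - (α + β) / 2| ≤ ‖raySymbol T lam η α (-y) R u‖ + ‖raySymbol T lam η β y R u‖ +
      (1 + K) * lam ^ 2 := by
  have h1 := (abs_le.1 (Complex.abs_re_le_norm (raySymbol T lam η α (-y) R u)))
  have h2 := (abs_le.1 (Complex.abs_re_le_norm (raySymbol T lam η β y R u)))
  rw [raySymbol_re] at h1 h2
  have h3 := abs_le.1 ((Complex.abs_re_le_norm (T (shiftedEnergy (-y) R u))).trans (hTb _))
  have h4 := abs_le.1 ((Complex.abs_re_le_norm (T (shiftedEnergy y R u))).trans (hTb _))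
  have h6 : lam ^ 4 ≤ lam ^ 2 := pow_le_pow_of_le_one hlam.le hlam1 (by norm_num)
  have h0 : 0 ≤ lam ^ 2 := by positivity
  have n1 := norm_nonneg (raySymbol T lam η α (-y) R u)
  have n2 := norm_nonneg (raySymbol T lam η β y R u)
  have e : shiftedEnergy (-y) R u + shiftedEnergy y R u = 2 * u + 2 * R := by
    simp only [shiftedEnergy]; ring
  rw [abs_le]
  constructor <;> nlinarith

lemma abs_sub_le_frozenSymbol_pair (hTb : ∀ u, ‖T u‖ ≤ K) {α β : ℝ} (γ u : ℝ) :
    |u - (α + β) / 2| ≤ ‖frozenSymbol T lam η α (-y) γ u‖ + ‖frozenSymbol T lam η β y γ u‖ +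
      (1 + K) * lam ^ 2 := by
  have h1 := (abs_le.1 (Complex.abs_re_le_norm (frozenSymbol T lam η α (-y) γ u)))
  have h2 := (abs_le.1 (Complex.abs_re_le_norm (frozenSymbol T lam η β y γ u)))
  rw [frozenSymbol_re] at h1 h2
  have h3 := abs_le.1 ((Complex.abs_re_le_norm (T γ)).trans (hTb _))
  have h0 : 0 ≤ lam ^ 2 := by positivity
  have n1 := norm_nonneg (frozenSymbol T lam η α (-y) γ u)
  have n2 := norm_nonneg (frozenSymbol T lam η β y γ u)
  rw [abs_le]
  constructor <;> nlinarith

end Symbols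

/-! ### Comparison with the on-shell value along one ray -/

/-- Replacing one factor at a time leaves three resolvents in each error. They are grouped so that
the pairs are (A, B) and (A₀, B₀), for which the gap bound holds; the remaining resolvent is
estimated by 1/η. -/
lemma inv_mul_sub_inv_mul {A B A₀ B₀ : ℂ} (hA : A ≠ 0) (hB : B ≠ 0) (hA₀ : A₀ ≠ 0) (hB₀ : B₀ ≠ 0) :
    1 / (A * B) = (A₀ - A) / (A₀ * (A * B)) + (B₀ - B) / (B * (A₀ * B₀)) + 1 / (A₀ * B₀) := by
  field_simp
  ring

/-- Constant of the ray estimate. -/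
def rayConst (K : ℝ) : ℝ := (5 + 4 * K) * pairConst (1 + K)

lemma rayConst_nonneg {K : ℝ} (hK : 0 ≤ K) : 0 ≤ rayConst K := by
  have := pairConst_nonneg (1 + K)
  unfold rayConst
  positivity

/-- Comparison of the energy integral of a product of two resolvents along a ray with its
on-shell value. -/
lemma ray_integral_estimate {T : ℝ → ℂ} {K lam η α β y R N : ℝ} {g : ℝ → ℂ}
    (hK : 0 ≤ K) (hTb : ∀ u, ‖T u‖ ≤ K) (hT : ∀ u v, ‖T u - T v‖ ≤ K * √|u - v|)
    (hTi : ∀ u, (T u).im ≤ 0) (hlam : 0 < lam) (hlam1 : lam ≤ 1) (hη : 0 < η)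
    (hηl : η ≤ lam ^ 2) (hη4 : (9 + 4 * K ^ 2) * lam ^ 4 ≤ η)
    (hy : |y| ≤ lam ^ 2) (hR : 0 ≤ R) (hR2 : R ≤ lam ^ 4)
    (hg : Continuous g) (hg0 : ∀ u ≤ 0, g u = 0) (hN : 0 ≤ N)
    (hg1 : ∀ u, ‖g u‖ * (1 + √(2 * u)) ≤ N)
    (hg2 : ∀ u v, ‖g u - g v‖ ≤ N * √|u - v|) :
    ‖(∫ u in Ioi 0, g u / ((starRingEnd ℂ) (raySymbol T lam η α (-y) R u) *
        raySymbol T lam η β y R u)) -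
      g ((α + β) / 2) * (-2 * Real.pi * I / ((α : ℂ) - β + 2 * (√(2 * ((α + β) / 2)) * y : ℝ) -
        2 * I * ((η - lam ^ 2 * (T ((α + β) / 2)).im : ℝ) : ℂ)))‖ ≤
      rayConst K * N * (lam / η + lam ^ 3 / η ^ 2) := by
  set γ := (α + β) / 2 with hγ
  set A := fun u => (starRingEnd ℂ) (raySymbol T lam η α (-y) R u) with hA
  set B := raySymbol T lam η β y R with hB
  set A₀ := fun u => (starRingEnd ℂ) (frozenSymbol T lam η α (-y) γ u) with hA₀
  set B₀ := frozenSymbol T lam η β y γ with hB₀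
  have hTc := continuous_of_sqrt_modulus hT
  have cA : Continuous A := Complex.continuous_conj.comp (continuous_raySymbol hTc)
  have cB : Continuous B := continuous_raySymbol hTc
  have cA₀ : Continuous A₀ := Complex.continuous_conj.comp (continuous_frozenSymbol γ)
  have cB₀ : Continuous B₀ := continuous_frozenSymbol γ
  have nA : ∀ u, ‖A u‖ = ‖raySymbol T lam η α (-y) R u‖ := fun u => RCLike.norm_conj _
  have nA₀ : ∀ u, ‖A₀ u‖ = ‖frozenSymbol T lam η α (-y) γ u‖ := fun u => RCLike.norm_conj _
  have lA : ∀ u, η ≤ ‖A u‖ := fun u => by rw [nA]; exact le_norm_raySymbol hTi u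
  have lB : ∀ u, η ≤ ‖B u‖ := fun u => le_norm_raySymbol hTi u
  have lA₀ : ∀ u, η ≤ ‖A₀ u‖ := fun u => by rw [nA₀]; exact le_norm_frozenSymbol hTi γ u
  have lB₀ : ∀ u, η ≤ ‖B₀ u‖ := fun u => le_norm_frozenSymbol hTi γ u
  have zA : ∀ u, A u ≠ 0 := fun u => norm_pos_iff.1 (hη.trans_le (lA u))
  have zB : ∀ u, B u ≠ 0 := fun u => norm_pos_iff.1 (hη.trans_le (lB u))
  have zA₀ : ∀ u, A₀ u ≠ 0 := fun u => norm_pos_iff.1 (hη.trans_le (lA₀ u))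
  have zB₀ : ∀ u, B₀ u ≠ 0 := fun u => norm_pos_iff.1 (hη.trans_le (lB₀ u))
  have hy' : |-y| ≤ lam ^ 2 := by rwa [abs_neg]
  obtain ⟨xA, hxA⟩ : ∃ u₀, ∀ u ∈ (univ : Set ℝ), |u - u₀| + η ≤ 9 * ‖raySymbol T lam η α (-y) R u‖ :=
    exists_center univ_nonempty hη (fun u _ => le_norm_raySymbol hTi u)
      fun u _ v _ => raySymbol_sub_le hT hy' hη4 u v
  obtain ⟨xB, hxB⟩ : ∃ u₀, ∀ u ∈ (univ : Set ℝ), |u - u₀| + η ≤ 9 * ‖B u‖ :=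
    exists_center univ_nonempty hη (fun u _ => lB u)
      fun u _ v _ => raySymbol_sub_le hT hy hη4 u v
  obtain ⟨xA₀, hxA₀⟩ : ∃ u₀, ∀ u ∈ (univ : Set ℝ),
      |u - u₀| + η ≤ 9 * ‖frozenSymbol T lam η α (-y) γ u‖ :=
    exists_center univ_nonempty hη (fun u _ => le_norm_frozenSymbol hTi γ u)
      fun u _ v _ => by rw [frozenSymbol_sub, norm_zero]; positivity
  obtain ⟨xB₀, hxB₀⟩ : ∃ u₀, ∀ u ∈ (univ : Set ℝ), |u - u₀| + η ≤ 9 * ‖B₀ u‖ :=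
    exists_center univ_nonempty hη (fun u _ => lB₀ u)
      fun u _ v _ => by rw [hB₀, frozenSymbol_sub, norm_zero]; positivity
  have hgap : ∀ u, |u - γ| ≤ ‖A u‖ + ‖B u‖ + (1 + K) * lam ^ 2 := fun u => by
    rw [nA]; exact abs_sub_le_raySymbol_pair hTb hlam hlam1 hR hR2 u
  have hgap₀ : ∀ u, |u - γ| ≤ ‖A₀ u‖ + ‖B₀ u‖ + (1 + K) * lam ^ 2 := fun u => by
    rw [nA₀]; exact abs_sub_le_frozenSymbol_pair hTb γ u
  have hdiff : ∀ u (D : ℝ), D ≤ (2 + 2 * K) * lam ^ 2 * (√|u - γ| + lam) * (1 + √(2 * u)) →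
      ‖g u‖ * D ≤ N * ((2 + 2 * K) * lam ^ 2 * (√|u - γ| + lam)) := by
    intro u D hD
    calc _ ≤ ‖g u‖ * ((2 + 2 * K) * lam ^ 2 * (√|u - γ| + lam) * (1 + √(2 * u))) := by gcongr
      _ = (‖g u‖ * (1 + √(2 * u))) * ((2 + 2 * K) * lam ^ 2 * (√|u - γ| + lam)) := by ring
      _ ≤ _ := by gcongr; exact hg1 u
  have dA : ∀ u, ‖A₀ u - A u‖ ≤ (2 + 2 * K) * lam ^ 2 * (√|u - γ| + lam) * (1 + √(2 * u)) := by
    intro u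
    rw [norm_sub_rev, hA, hA₀]
    simp only
    rw [← map_sub, RCLike.norm_conj]
    exact raySymbol_sub_frozenSymbol_le hK hT hlam hlam1 hy' hR hR2 γ u
  have dB : ∀ u, ‖B₀ u - B u‖ ≤ (2 + 2 * K) * lam ^ 2 * (√|u - γ| + lam) * (1 + √(2 * u)) := by
    intro u
    rw [norm_sub_rev]
    exact raySymbol_sub_frozenSymbol_le hK hT hlam hlam1 hy hR hR2 γ u
  set h₁ : ℝ → ℂ := fun u => g u * ((A₀ u - A u) / (A₀ u * (A u * B u))) with hh₁
  set h₂ : ℝ → ℂ := fun u => g u * ((B₀ u - B u) / (B u * (A₀ u * B₀ u))) with hh₂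
  set h₃ : ℝ → ℂ := fun u => (g u - g γ) * (1 / (A₀ u * B₀ u)) with hh₃
  set h₄ : ℝ → ℂ := fun u => 1 / (A₀ u * B₀ u) with hh₄
  have c₁ : Continuous h₁ := hg.mul ((cA₀.sub cA).div (cA₀.mul (cA.mul cB))
    fun u => mul_ne_zero (zA₀ u) (mul_ne_zero (zA u) (zB u)))
  have c₂ : Continuous h₂ := hg.mul ((cB₀.sub cB).div (cB.mul (cA₀.mul cB₀))
    fun u => mul_ne_zero (zB u) (mul_ne_zero (zA₀ u) (zB₀ u)))
  have c₃ : Continuous h₃ := (hg.sub continuous_const).mul (continuous_const.div (cA₀.mul cB₀)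
    fun u => mul_ne_zero (zA₀ u) (zB₀ u))
  have b₁ := pair_integral_le (s := Ioi 0) (K := 1 + K) (γ := γ) (X := A) (Y := B) (h := h₁)
    (c := N * (2 + 2 * K) * lam ^ 2 / η)
    measurableSet_Ioi hη hlam hηl (fun u _ => by rw [nA]; exact hxA u trivial)
    (fun u _ => hxB u trivial) (by positivity) (fun u _ => hgap u) (by positivity) (fun u _ => by
      have p1 := hη.trans_le (lA u)
      have p2 := hη.trans_le (lB u)
      rw [hh₁, norm_mul, norm_div, norm_mul, norm_mul, ← mul_div_assoc]
      calc _ ≤ N * ((2 + 2 * K) * lam ^ 2 * (√|u - γ| + lam)) / (η * (‖A u‖ * ‖B u‖)) := by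
            exact div_le_div₀ (by positivity) (hdiff u _ (dA u)) (by positivity)
              (mul_le_mul_of_nonneg_right (lA₀ u) (by positivity))
        _ = _ := by field_simp)
  have b₂ := pair_integral_le (s := Ioi 0) (K := 1 + K) (γ := γ) (X := A₀) (Y := B₀) (h := h₂)
    (c := N * (2 + 2 * K) * lam ^ 2 / η)
    measurableSet_Ioi hη hlam hηl (fun u _ => by rw [nA₀]; exact hxA₀ u trivial)
    (fun u _ => hxB₀ u trivial) (by positivity) (fun u _ => hgap₀ u) (by positivity) (fun u _ => by
      have p1 := hη.trans_le (lA₀ u)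
      have p2 := hη.trans_le (lB₀ u)
      rw [hh₂, norm_mul, norm_div, norm_mul, norm_mul, ← mul_div_assoc]
      calc _ ≤ N * ((2 + 2 * K) * lam ^ 2 * (√|u - γ| + lam)) / (η * (‖A₀ u‖ * ‖B₀ u‖)) := by
            exact div_le_div₀ (by positivity) (hdiff u _ (dB u)) (by positivity)
              (mul_le_mul_of_nonneg_right (lB u) (by positivity))
        _ = _ := by field_simp)
  -- This error is integrated over all of ℝ, because the frozen pair is evaluated exactly only
  -- there; nothing is added, as g vanishes on u ≤ 0.
  have b₃ := pair_integral_le (s := univ) (K := 1 + K) (γ := γ) (X := A₀) (Y := B₀) (h := h₃)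
    (c := N)
    MeasurableSet.univ hη hlam hηl (fun u _ => by rw [nA₀]; exact hxA₀ u trivial)
    (fun u _ => hxB₀ u trivial) (by positivity) (fun u _ => hgap₀ u) hN (fun u _ => by
      have p1 := hη.trans_le (lA₀ u)
      have p2 := hη.trans_le (lB₀ u)
      rw [hh₃, norm_mul, norm_div, norm_mul, norm_one, ← mul_div_assoc, ← mul_div_assoc, mul_one]
      gcongr
      refine (hg2 u γ).trans ?_
      gcongr
      linarith)
  have i₁ : IntegrableOn h₁ (Ioi 0) := b₁.1 c₁.aestronglyMeasurable
  have i₂ : IntegrableOn h₂ (Ioi 0) := b₂.1 c₂.aestronglyMeasurable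
  have i₃ : Integrable h₃ := integrableOn_univ.1 (b₃.1 c₃.aestronglyMeasurable)
  -- The width η + λ² I(γ) of the on-shell denominator. The real parts of the frozen self-energy
  -- cancel in a - b, the imaginary parts add because one factor is conjugated.
  set η' := η - lam ^ 2 * (T γ).im with hη'
  have hη'0 : 0 < η' := by
    have := mul_nonneg (sq_nonneg lam) (neg_nonneg.2 (hTi γ))
    simp only [hη']
    linarith
  set a := α + √(2 * γ) * y - lam ^ 2 * (T γ).re with ha
  set b := β - √(2 * γ) * y - lam ^ 2 * (T γ).re with hb
  have eA₀ : ∀ u : ℝ, A₀ u = (a : ℂ) - u - I * η' := by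
    intro u
    apply Complex.ext
    · simp only [hA₀, Complex.conj_re, frozenSymbol_re, ha]
      simp [-ofReal_sub, -ofReal_add, -ofReal_mul, -ofReal_pow]
      ring
    · simp only [hA₀, Complex.conj_im, frozenSymbol_im, hη']
      simp [-ofReal_sub, -ofReal_mul, -ofReal_pow]
  have eB₀ : ∀ u : ℝ, B₀ u = (b : ℂ) - u + I * η' := by
    intro u
    apply Complex.ext
    · simp only [hB₀, frozenSymbol_re, hb]
      simp [-ofReal_sub, -ofReal_add, -ofReal_mul, -ofReal_pow]
      ring
    · simp only [hB₀, frozenSymbol_im, hη']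
      simp [-ofReal_sub, -ofReal_mul, -ofReal_pow]
  obtain ⟨i₄, e₄⟩ := integral_resolvent_pair a b hη'0
  have e₄' : ∫ u, h₄ u = -2 * Real.pi * I / ((α : ℂ) - β + 2 * (√(2 * γ) * y : ℝ) -
      2 * I * (η' : ℂ)) := by
    simp only [hh₄, eA₀, eB₀]
    rw [e₄, ha, hb]
    congr 1
    push_cast
    ring
  have i₄ : Integrable h₄ := by simpa only [hh₄, eA₀, eB₀] using i₄
  have i₅ : Integrable fun u => h₃ u + g γ * h₄ u := i₃.add (i₄.const_mul _)
  have e₅ : ∀ u, h₃ u + g γ * h₄ u = g u * h₄ u := by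
    intro u
    simp only [hh₃, hh₄]
    ring
  simp only [e₅] at i₅
  have e₆ : ∫ u in Ioi 0, g u * h₄ u = (∫ u, h₃ u) + g γ * ∫ u, h₄ u := by
    rw [setIntegral_eq_integral_of_forall_compl_eq_zero, ← integral_const_mul,
      ← integral_add i₃ (i₄.const_mul _)]
    · simp only [e₅]
    · intro u hu
      rw [hg0 u (not_lt.1 hu), zero_mul]
  have e₇ : ∫ u in Ioi 0, g u / (A u * B u) =
      (∫ u in Ioi 0, h₁ u) + (∫ u in Ioi 0, h₂ u) + ((∫ u, h₃ u) + g γ * ∫ u, h₄ u) := by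
    have i₁₂ : IntegrableOn (fun u => h₁ u + h₂ u) (Ioi 0) := i₁.add i₂
    rw [← e₆, ← integral_add i₁ i₂, ← integral_add i₁₂ i₅.integrableOn]
    refine integral_congr_ae (Eventually.of_forall fun u => ?_)
    beta_reduce
    rw [div_eq_mul_one_div, inv_mul_sub_inv_mul (zA u) (zB u) (zA₀ u) (zB₀ u)]
    simp only [hh₁, hh₂, hh₄]
    ring
  rw [e₇, ← e₄']
  have b₃' := b₃.2
  rw [setIntegral_univ] at b₃'
  have p0 := pairConst_nonneg (1 + K)
  calc _ = ‖(∫ u in Ioi 0, h₁ u) + (∫ u in Ioi 0, h₂ u) + ∫ u, h₃ u‖ := by congr 1; ring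
    _ ≤ _ := norm_add₃_le
    _ ≤ N * (2 + 2 * K) * lam ^ 2 / η * pairConst (1 + K) * (lam / η) +
        N * (2 + 2 * K) * lam ^ 2 / η * pairConst (1 + K) * (lam / η) +
        N * pairConst (1 + K) * (lam / η) := by
      gcongr
      · exact b₁.2
      · exact b₂.2
    _ = pairConst (1 + K) * N * ((4 + 4 * K) * (lam ^ 3 / η ^ 2) + 1 * (lam / η)) := by
      field_simp
      ring
    _ ≤ pairConst (1 + K) * N * ((5 + 4 * K) * (lam ^ 3 / η ^ 2) + (5 + 4 * K) * (lam / η)) := by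
      gcongr
      · linarith
      · linarith
    _ = _ := by
      rw [rayConst]
      ring

/-! ### Weighted norm and the density along rays -/

section WeightedNorm

variable {d m : ℕ} {f : Mom d → ℂ}

lemma bracket_pow_mul_norm_le (h : weightedC1Norm m f < ⊤) (x : Mom d) :
    bracket x ^ m * ‖f x‖ ≤ (weightedC1Norm m f).toReal := by
  rw [← ENNReal.ofReal_le_iff_le_toReal h.ne]
  exact (le_iSup (fun x : Mom d => ENNReal.ofReal (bracket x ^ m * ‖f x‖)) x).trans le_self_add

lemma norm_clm_le_sum (L : Mom d →L[ℝ] ℂ) :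
    ‖L‖ ≤ ∑ i : Fin d, ‖L (EuclideanSpace.single i (1 : ℝ))‖ := by
  refine L.opNorm_le_bound (Finset.sum_nonneg fun _ _ => norm_nonneg _) fun v => ?_
  have hv : v = ∑ i, v i • EuclideanSpace.single i (1 : ℝ) := by
    conv_lhs => rw [← (EuclideanSpace.basisFun (Fin d) ℝ).sum_repr v]
    simp
  conv_lhs => rw [hv, map_sum]
  rw [Finset.sum_mul]
  refine (norm_sum_le _ _).trans (Finset.sum_le_sum fun i _ => ?_)
  rw [map_smul, norm_smul, mul_comm]
  gcongr
  exact PiLp.norm_apply_le v i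

lemma bracket_nonneg (x : Mom d) : 0 ≤ bracket x := Real.sqrt_nonneg _

lemma bracket_pow_mul_norm_fderiv_le (h : weightedC1Norm m f < ⊤) (x : Mom d) :
    bracket x ^ m * ‖fderiv ℝ f x‖ ≤ (weightedC1Norm m f).toReal := by
  have hb := bracket_nonneg x
  rw [← ENNReal.ofReal_le_iff_le_toReal h.ne]
  calc _ ≤ ENNReal.ofReal (∑ i : Fin d,
        bracket x ^ m * ‖fderiv ℝ f x (EuclideanSpace.single i (1 : ℝ))‖) := by
        rw [← Finset.mul_sum]
        gcongr
        exact norm_clm_le_sum _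
    _ = ∑ i : Fin d, ENNReal.ofReal
        (bracket x ^ m * ‖fderiv ℝ f x (EuclideanSpace.single i (1 : ℝ))‖) :=
        ENNReal.ofReal_sum_of_nonneg fun _ _ => by positivity
    _ ≤ ∑ i : Fin d, ⨆ x : Mom d, ENNReal.ofReal
        (bracket x ^ m * ‖fderiv ℝ f x (EuclideanSpace.single i (1 : ℝ))‖) :=
        Finset.sum_le_sum fun i _ => le_iSup (fun x : Mom d => ENNReal.ofReal
          (bracket x ^ m * ‖fderiv ℝ f x (EuclideanSpace.single i (1 : ℝ))‖)) x
    _ ≤ _ := le_add_self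

lemma one_le_bracket (x : Mom d) : 1 ≤ bracket x := by
  rw [bracket, Real.one_le_sqrt]
  have := sq_nonneg ‖x‖
  linarith

lemma norm_le_bracket (x : Mom d) : ‖x‖ ≤ bracket x :=
  Real.le_sqrt_of_sq_le (by linarith)

lemma pow_mul_norm_le {k : ℕ} (hk : k ≤ m) (h : weightedC1Norm m f < ⊤) (x : Mom d) :
    ‖x‖ ^ k * ‖f x‖ ≤ (weightedC1Norm m f).toReal := by
  refine le_trans ?_ (bracket_pow_mul_norm_le h x)
  gcongr
  exact (pow_le_pow_left₀ (norm_nonneg _) (norm_le_bracket x) k).trans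
    (pow_le_pow_right₀ (one_le_bracket x) hk)

lemma pow_mul_norm_fderiv_le {k : ℕ} (hk : k ≤ m) (h : weightedC1Norm m f < ⊤) (x : Mom d) :
    ‖x‖ ^ k * ‖fderiv ℝ f x‖ ≤ (weightedC1Norm m f).toReal := by
  refine le_trans ?_ (bracket_pow_mul_norm_fderiv_le h x)
  gcongr
  exact (pow_le_pow_left₀ (norm_nonneg _) (norm_le_bracket x) k).trans
    (pow_le_pow_right₀ (one_le_bracket x) hk)

lemma integrable_of_weightedC1Norm (hd : 0 < d) (hf : Continuous f)
    (h : weightedC1Norm (4 * d) f < ⊤) : Integrable f := by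
  have hi : Integrable fun x : Mom d => (1 + ‖x‖ ^ 2) ^ (-(4 * d : ℝ) / 2) := by
    refine integrable_rpow_neg_one_add_norm_sq ?_
    have : (0 : ℝ) < d := by exact_mod_cast hd
    simp
    linarith
  refine (hi.const_mul (weightedC1Norm (4 * d) f).toReal).mono' hf.aestronglyMeasurable
    (Eventually.of_forall fun x => ?_)
  have h1 := bracket_pow_mul_norm_le h x
  have hp : (0 : ℝ) < 1 + ‖x‖ ^ 2 := by positivity
  have h2 : (1 + ‖x‖ ^ 2) ^ (-(4 * d : ℝ) / 2) = ((1 + ‖x‖ ^ 2) ^ (2 * d))⁻¹ := by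
    rw [← Real.rpow_natCast (1 + ‖x‖ ^ 2) (2 * d), ← Real.rpow_neg hp.le]
    congr 1
    push_cast
    ring
  have h3 : (1 + ‖x‖ ^ 2) ^ (2 * d) ≤ bracket x ^ (4 * d) := by
    have : bracket x ^ (4 * d) = (2 + ‖x‖ ^ 2) ^ (2 * d) := by
      rw [show 4 * d = 2 * (2 * d) by ring, pow_mul, bracket, Real.sq_sqrt (by positivity)]
    rw [this]
    gcongr
    norm_num
  rw [h2, ← div_eq_mul_inv, le_div_iff₀ (by positivity)]
  calc _ ≤ ‖f x‖ * bracket x ^ (4 * d) := by gcongr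
    _ ≤ _ := by linarith

end WeightedNorm

/-- The restriction of `f` to the ray through `θ`, in the energy variable and with the density of
the energy shells. -/
def rayDensity {d : ℕ} (f : Mom d → ℂ) (θ : Mom d) (u : ℝ) : ℂ :=
  ((√(2 * u) ^ (d - 2) : ℝ) : ℂ) * f (√(2 * u) • θ)

section RayDensity

variable {d : ℕ} {f : Mom d → ℂ} {θ : Mom d}

lemma rayDensity_of_nonpos (hd : 3 ≤ d) {u : ℝ} (hu : u ≤ 0) : rayDensity f θ u = 0 := by
  have h0 : √(2 * u) = 0 := Real.sqrt_eq_zero_of_nonpos (by linarith)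
  have h1 : d - 2 ≠ 0 := by omega
  simp [rayDensity, h0, h1]

lemma continuous_rayDensity (hf : Continuous f) : Continuous (rayDensity f θ) := by
  unfold rayDensity
  fun_prop

lemma norm_rayDensity_mul_le (hd : 3 ≤ d) (hθ : ‖θ‖ = 1) (h : weightedC1Norm (4 * d) f < ⊤)
    (u : ℝ) : ‖rayDensity f θ u‖ * (1 + √(2 * u)) ≤ 2 * d * (weightedC1Norm (4 * d) f).toReal := by
  set ρ := √(2 * u) with hρ
  have hρ0 : 0 ≤ ρ := Real.sqrt_nonneg _
  have hx : ‖ρ • θ‖ = ρ := by rw [norm_smul, hθ, mul_one, Real.norm_of_nonneg hρ0]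
  have h1 := pow_mul_norm_le (k := d - 2) (by omega) h (ρ • θ)
  have h2 := pow_mul_norm_le (k := d - 2 + 1) (by omega) h (ρ • θ)
  rw [hx] at h1 h2
  have hd' : (3 : ℝ) ≤ d := by exact_mod_cast hd
  have hN : 0 ≤ (weightedC1Norm (4 * d) f).toReal := ENNReal.toReal_nonneg
  rw [rayDensity, norm_mul, Complex.norm_real, Real.norm_of_nonneg (by positivity)]
  calc _ = ρ ^ (d - 2) * ‖f (ρ • θ)‖ + ρ ^ (d - 2 + 1) * ‖f (ρ • θ)‖ := by rw [pow_succ]; ring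
    _ ≤ _ := by nlinarith

/-- The density is Lipschitz in the radius ρ ≥ 0, by the weighted bounds on f and its derivative,
and ρ = √(2u) is Hölder-1/2 in u. -/
lemma norm_rayDensity_sub_le (hd : 3 ≤ d) (hθ : ‖θ‖ = 1) (hf : ContDiff ℝ 1 f)
    (h : weightedC1Norm (4 * d) f < ⊤) (u v : ℝ) :
    ‖rayDensity f θ u - rayDensity f θ v‖ ≤
      2 * d * (weightedC1Norm (4 * d) f).toReal * √|u - v| := by
  set N := (weightedC1Norm (4 * d) f).toReal with hN
  have hN0 : 0 ≤ N := ENNReal.toReal_nonneg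
  obtain ⟨n, rfl⟩ : ∃ n, d = n + 3 := ⟨d - 3, by omega⟩
  set G : ℝ → ℂ := fun ρ => ((ρ ^ (n + 1) : ℝ) : ℂ) * f (ρ • θ) with hG
  set G' : ℝ → ℂ := fun ρ => (((n + 1 : ℕ) * ρ ^ n : ℝ) : ℂ) * f (ρ • θ) +
    ((ρ ^ (n + 1) : ℝ) : ℂ) * fderiv ℝ f (ρ • θ) θ with hG'
  have hder : ∀ ρ, HasDerivAt G (G' ρ) ρ := by
    intro ρ
    have d1 : HasDerivAt (fun ρ : ℝ => ((ρ ^ (n + 1) : ℝ) : ℂ)) (((n + 1 : ℕ) * ρ ^ n : ℝ) : ℂ) ρ := by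
      have := (hasDerivAt_pow (n + 1) ρ).ofReal_comp
      simpa using this
    have d2 : HasDerivAt (fun ρ : ℝ => f (ρ • θ)) (fderiv ℝ f (ρ • θ) θ) ρ := by
      have e1 : HasDerivAt (fun ρ : ℝ => ρ • θ) θ ρ := by
        simpa using (hasDerivAt_id ρ).smul_const θ
      exact ((hf.differentiable one_ne_zero).differentiableAt.hasFDerivAt).comp_hasDerivAt ρ e1
    exact d1.mul d2
  have hbound : ∀ ρ ∈ Ici (0 : ℝ), ‖G' ρ‖ ≤ ((n + 3 : ℕ) : ℝ) * N := by
    intro ρ hρ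
    have hρ0 : 0 ≤ ρ := hρ
    have hx : ‖ρ • θ‖ = ρ := by rw [norm_smul, hθ, mul_one, Real.norm_of_nonneg hρ0]
    have h1 := pow_mul_norm_le (k := n) (by omega) h (ρ • θ)
    have h2 := pow_mul_norm_fderiv_le (k := n + 1) (by omega) h (ρ • θ)
    rw [hx] at h1 h2
    refine (norm_add_le _ _).trans ?_
    rw [norm_mul, norm_mul, Complex.norm_real, Complex.norm_real,
      Real.norm_of_nonneg (by positivity), Real.norm_of_nonneg (by positivity)]
    have h3 : ‖fderiv ℝ f (ρ • θ) θ‖ ≤ ‖fderiv ℝ f (ρ • θ)‖ := by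
      simpa [hθ] using (fderiv ℝ f (ρ • θ)).le_opNorm θ
    calc _ ≤ ((n + 1 : ℕ) : ℝ) * (ρ ^ n * ‖f (ρ • θ)‖) + ρ ^ (n + 1) * ‖fderiv ℝ f (ρ • θ)‖ := by
          rw [mul_assoc]
          gcongr
      _ ≤ ((n + 1 : ℕ) : ℝ) * N + N := by gcongr
      _ ≤ _ := by push_cast; linarith
  have hlip := (convex_Ici (0 : ℝ)).norm_image_sub_le_of_norm_hasDerivWithin_le
    (fun ρ _ => (hder ρ).hasDerivWithinAt) hbound (mem_Ici.2 (Real.sqrt_nonneg (2 * v)))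
    (mem_Ici.2 (Real.sqrt_nonneg (2 * u)))
  refine hlip.trans ?_
  rw [Real.norm_eq_abs]
  calc _ ≤ ((n + 3 : ℕ) : ℝ) * N * (2 * √|u - v|) := by
        gcongr
        exact abs_sqrt_two_mul_sub_le u v
    _ = _ := by ring

end RayDensity

/-! ### Polar coordinates in the energy variable -/

lemma integral_Ioi_energy (n : ℕ) (H : ℝ → ℂ) :
    ∫ ρ in Ioi (0 : ℝ), ρ ^ (n + 1) • H ρ = ∫ u in Ioi (0 : ℝ), √(2 * u) ^ n • H √(2 * u) := by
  have himg : (fun u : ℝ => √(2 * u)) '' Ioi 0 = Ioi 0 := by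
    ext ρ
    constructor
    · rintro ⟨u, hu, rfl⟩
      exact Real.sqrt_pos.2 (mul_pos two_pos hu)
    · intro hρ
      refine ⟨ρ ^ 2 / 2, ?_, ?_⟩
      · have : 0 < ρ := hρ
        exact mem_Ioi.2 (by positivity)
      · simp only
        rw [mul_div_cancel₀ _ (two_ne_zero)]
        exact Real.sqrt_sq (le_of_lt hρ)
  have hinj : InjOn (fun u : ℝ => √(2 * u)) (Ioi 0) := by
    intro u hu v hv huv
    have hu : 0 < u := hu
    have hv : 0 < v := hv
    have := (Real.sqrt_inj (by positivity) (by positivity)).1 huv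
    linarith
  have hder : ∀ u ∈ Ioi (0 : ℝ), HasDerivWithinAt (fun u : ℝ => √(2 * u)) (1 / √(2 * u)) (Ioi 0) u := by
    intro u hu
    have hu : 0 < u := hu
    have h1 : HasDerivAt (fun u : ℝ => 2 * u) 2 u := by
      simpa using (hasDerivAt_id u).const_mul (2 : ℝ)
    have h2 := h1.sqrt (by positivity)
    refine (h2.congr_deriv ?_).hasDerivWithinAt
    have : 0 < √(2 * u) := Real.sqrt_pos.2 (by positivity)
    field_simp
  have h := integral_image_eq_integral_abs_deriv_smul measurableSet_Ioi hder hinj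
    (fun ρ => ρ ^ (n + 1) • H ρ)
  rw [himg] at h
  rw [h]
  refine setIntegral_congr_fun measurableSet_Ioi fun u hu => ?_
  have hu : 0 < u := hu
  have hs : 0 < √(2 * u) := Real.sqrt_pos.2 (by positivity)
  rw [smul_smul, abs_of_pos (by positivity)]
  congr 1
  rw [pow_succ]
  field_simp

lemma integral_polar {d : ℕ} (hd : 3 ≤ d) {F : Mom d → ℂ} (hF : Integrable F) :
    Integrable (fun θ : Metric.sphere (0 : Mom d) 1 => ∫ u in Ioi (0 : ℝ),
      √(2 * u) ^ (d - 2) • F (√(2 * u) • (θ : Mom d))) (volume : Measure (Mom d)).toSphere ∧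
    ∫ p, F p = ∫ θ : Metric.sphere (0 : Mom d) 1, (∫ u in Ioi (0 : ℝ),
      √(2 * u) ^ (d - 2) • F (√(2 * u) • (θ : Mom d))) ∂(volume : Measure (Mom d)).toSphere := by
  have : NeZero d := ⟨by omega⟩
  set μ : Measure (Mom d) := volume
  set g : Metric.sphere (0 : Mom d) 1 × Ioi (0 : ℝ) → ℂ :=
    fun z => F ((z.2 : ℝ) • (z.1 : Mom d)) with hg
  have hcomp : ∀ x : ({0}ᶜ : Set (Mom d)), g (homeomorphUnitSphereProd (Mom d) x) = F x := by
    intro x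
    have hx : ‖(x : Mom d)‖ ≠ 0 := norm_ne_zero_iff.2 x.2
    simp [hg, smul_smul, hx]
  have mp := μ.measurePreserving_homeomorphUnitSphereProd
  have emb := (homeomorphUnitSphereProd (Mom d)).measurableEmbedding
  have hFi : Integrable (fun x : ({0}ᶜ : Set (Mom d)) => F x) (μ.comap (↑)) :=
    (integrableOn_iff_comap_subtypeVal (measurableSet_singleton _).compl).1 hF.integrableOn
  have hgi : Integrable g (μ.toSphere.prod (Measure.volumeIoiPow (Module.finrank ℝ (Mom d) - 1))) := by
    refine (mp.integrable_comp_emb emb).1 (hFi.congr (Eventually.of_forall fun x => ?_))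
    exact (hcomp x).symm
  have hinner : ∀ θ : Metric.sphere (0 : Mom d) 1,
      ∫ ρ, g (θ, ρ) ∂(Measure.volumeIoiPow (Module.finrank ℝ (Mom d) - 1)) =
      ∫ u in Ioi (0 : ℝ), √(2 * u) ^ (d - 2) • F (√(2 * u) • (θ : Mom d)) := by
    intro θ
    rw [← integral_Ioi_energy (d - 2) (fun ρ => F (ρ • (θ : Mom d)))]
    have hdim : Module.finrank ℝ (Mom d) - 1 = d - 2 + 1 := by
      rw [finrank_euclideanSpace, Fintype.card_fin]; omega
    rw [hdim]
    simp only [Measure.volumeIoiPow, ENNReal.ofReal]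
    rw [integral_withDensity_eq_integral_smul,
      integral_subtype_comap measurableSet_Ioi
        fun a => Real.toNNReal (a ^ (d - 2 + 1)) • F (a • (θ : Mom d)),
      setIntegral_congr_fun measurableSet_Ioi fun x hx => ?_]
    · rw [NNReal.smul_def, Real.coe_toNNReal _ (pow_nonneg hx.out.le _)]
    · exact (measurable_subtype_coe.pow_const _).real_toNNReal
  refine ⟨?_, ?_⟩
  · refine hgi.integral_prod_left.congr (Eventually.of_forall fun θ => ?_)
    exact hinner θ
  · calc ∫ p, F p = ∫ x : ({0}ᶜ : Set (Mom d)), F x ∂(μ.comap (↑)) := by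
          rw [integral_subtype_comap (measurableSet_singleton _).compl F, restrict_compl_singleton]
      _ = ∫ z, g z ∂(μ.toSphere.prod (Measure.volumeIoiPow (Module.finrank ℝ (Mom d) - 1))) := by
          rw [← mp.integral_comp emb]
          simp only [hcomp]
      _ = _ := by
          rw [integral_prod _ hgi]
          simp only [hinner]

/-- The radial weight ρ^(d-1) divided by |∇e| = ρ is ρ^(d-2), the same density as in the energy form
of polar coordinates. For γ ≤ 0 both sides vanish since √(2γ) = 0 and d - 2 > 0. -/
lemma deltaIntegral_eq {d : ℕ} (hd : 3 ≤ d) {h : Mom d → ℂ} (hh : Continuous h) (γ : ℝ) :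
    deltaIntegral h γ = ∫ θ : Metric.sphere (0 : Mom d) 1,
      √(2 * γ) ^ (d - 2) • h (√(2 * γ) • (θ : Mom d)) ∂(volume : Measure (Mom d)).toSphere := by
  have hd2 : d - 2 ≠ 0 := by omega
  unfold deltaIntegral shellMeasure
  split_ifs with hγ
  · rw [integral_smul_measure, integral_map, ENNReal.toReal_ofReal (by positivity), ← integral_smul]
    · refine integral_congr_ae (Eventually.of_forall fun θ => ?_)
      have hθ : ‖(θ : Mom d)‖ = 1 := by simp
      beta_reduce
      rw [norm_smul, hθ, mul_one, Real.norm_of_nonneg (Real.sqrt_nonneg _)]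
      rcases (Real.sqrt_nonneg (2 * γ)).eq_or_lt' with h0 | h0
      · simp [h0, hd2]
      · have h1 : (√(2 * γ) : ℂ) ≠ 0 := by exact_mod_cast h0.ne'
        rw [show d - 1 = d - 2 + 1 by omega, pow_succ, Complex.real_smul, Complex.real_smul]
        push_cast
        field_simp
    · fun_prop
    · exact (hh.measurable.div (by fun_prop)).aestronglyMeasurable
  · have h0 : √(2 * γ) = 0 := Real.sqrt_eq_zero_of_nonpos (by linarith)
    simp [h0, hd2]

lemma integrable_shellMeasure {d : ℕ} {h : Mom d → ℂ} (hh : Continuous h) {M : ℝ}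
    (hM : ∀ q, ‖h q‖ ≤ M) (γ : ℝ) :
    Integrable (fun q => h q / ((‖q‖ : ℝ) : ℂ)) (shellMeasure d γ) := by
  have hm : Measurable fun q => h q / ((‖q‖ : ℝ) : ℂ) := hh.measurable.div (by fun_prop)
  unfold shellMeasure
  split_ifs with hγ
  · refine Integrable.smul_measure ?_ ENNReal.ofReal_ne_top
    rw [integrable_map_measure hm.aestronglyMeasurable (by fun_prop)]
    -- At γ = 0 the integrand and this bound are both 0, by division by zero.
    refine Integrable.of_bound (C := M / √(2 * γ))
      (hm.comp (by fun_prop)).aestronglyMeasurable (Eventually.of_forall fun θ => ?_)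
    have hθ : ‖(θ : Mom d)‖ = 1 := by simp
    simp only [Function.comp]
    rw [norm_div, norm_smul, hθ, mul_one, Complex.norm_real, norm_norm,
      Real.norm_of_nonneg (Real.sqrt_nonneg _)]
    gcongr
    exact hM _
  · exact integrable_zero_measure

/-! ### From rays to momentum space -/

lemma kin_nonneg {d : ℕ} (p : Mom d) : 0 ≤ kin p := by unfold kin; positivity

lemma kin_smul_add {d : ℕ} {θ : Mom d} (hθ : ‖θ‖ = 1) (r : Mom d) {u : ℝ} (hu : 0 ≤ u) :
    kin (√(2 * u) • θ + r) = shiftedEnergy (inner ℝ θ r) (kin r) u := by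
  unfold kin shiftedEnergy
  rw [norm_add_sq_real, norm_smul, hθ, mul_one, Real.norm_of_nonneg (Real.sqrt_nonneg _),
    Real.sq_sqrt (by positivity), real_inner_smul_left]
  ring

lemma selfEnergy_of_neg {d : ℕ} (B : 𝓢(Mom d, ℂ)) {γ : ℝ} (hγ : γ < 0) : selfEnergy B γ = 0 := by
  rw [selfEnergy, dif_neg]
  rintro ⟨r, hr⟩
  have := kin_nonneg r
  linarith

/-- The inverse resolvent with self-energy `T` and energy parameter `b + iη`. -/
def momSymbol {d : ℕ} (T : ℝ → ℂ) (lam η b : ℝ) (q : Mom d) : ℂ :=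
  (b : ℂ) - kin q - (lam : ℂ) ^ 2 * T (kin q) + I * η

section MomSymbol

variable {d : ℕ} {T : ℝ → ℂ} {lam η b : ℝ}

lemma continuous_momSymbol (hT : Continuous T) :
    Continuous (momSymbol T lam η b : Mom d → ℂ) := by
  unfold momSymbol kin
  fun_prop

lemma le_norm_momSymbol (hT : ∀ u, (T u).im ≤ 0) (q : Mom d) : η ≤ ‖momSymbol T lam η b q‖ := by
  refine le_trans ?_ ((le_abs_self _).trans (Complex.abs_im_le_norm _))
  have : (momSymbol T lam η b q).im = η - lam ^ 2 * (T (kin q)).im := by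
    simp only [momSymbol, Complex.add_im, Complex.sub_im, im_sq_mul]
    simp
    ring
  rw [this]
  nlinarith [mul_nonneg (sq_nonneg lam) (neg_nonneg.2 (hT (kin q)))]

lemma momSymbol_ray {θ : Mom d} (hθ : ‖θ‖ = 1) (r : Mom d) {u : ℝ} (hu : 0 ≤ u) :
    momSymbol T lam η b (√(2 * u) • θ + r) = raySymbol T lam η b (inner ℝ θ r) (kin r) u := by
  rw [momSymbol, raySymbol, kin_smul_add hθ r hu]

/-- Kinetic energies are nonnegative, so the extension T may replace the self-energy here. -/
lemma twoResolvent_eq {B : 𝓢(Mom d, ℂ)} (hT : ∀ u, 0 ≤ u → selfEnergy B u = T u) (α β : ℝ)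
    (r : Mom d) (f : Mom d → ℂ) (p : Mom d) :
    twoResolvent B lam η α β r f p = (lam : ℂ) ^ 2 * f p /
      ((starRingEnd ℂ) (momSymbol T lam η α (p - r)) * momSymbol T lam η β (p + r)) := by
  unfold twoResolvent renDisp momSymbol
  rw [hT _ (kin_nonneg _), hT _ (kin_nonneg _)]
  congr 2
  · simp only [map_add, map_sub, map_mul, map_pow, Complex.conj_ofReal, Complex.conj_I]
    ring
  · ring

lemma integrable_twoResolvent {B : 𝓢(Mom d, ℂ)} (hT : ∀ u, 0 ≤ u → selfEnergy B u = T u)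
    (hTc : Continuous T) (hTi : ∀ u, (T u).im ≤ 0) (hη : 0 < η) (α β : ℝ) (r : Mom d)
    {f : Mom d → ℂ} (hfc : Continuous f) (hf : Integrable f) :
    Integrable (twoResolvent B lam η α β r f) := by
  have h1 : ∀ p : Mom d, η ≤ ‖(starRingEnd ℂ) (momSymbol T lam η α (p - r))‖ := fun p => by
    rw [RCLike.norm_conj]; exact le_norm_momSymbol hTi _
  have h2 : ∀ p : Mom d, η ≤ ‖momSymbol T lam η β (p + r)‖ := fun p => le_norm_momSymbol hTi _
  have e : twoResolvent B lam η α β r f = _ := funext fun p => twoResolvent_eq hT α β r f p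
  rw [e]
  refine (hf.norm.const_mul (lam ^ 2 / (η * η))).mono' ?_ (Eventually.of_forall fun p => ?_)
  · apply Continuous.aestronglyMeasurable
    refine (continuous_const.mul hfc).div ?_ fun p => mul_ne_zero
      (norm_pos_iff.1 (hη.trans_le (h1 p))) (norm_pos_iff.1 (hη.trans_le (h2 p)))
    exact (Complex.continuous_conj.comp ((continuous_momSymbol hTc).comp
      (continuous_id.sub continuous_const))).mul
      ((continuous_momSymbol hTc).comp (continuous_id.add continuous_const))
  · rw [norm_div, norm_mul, norm_mul, norm_pow, Complex.norm_real, Real.norm_eq_abs, sq_abs,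
      div_mul_eq_mul_div]
    exact div_le_div_of_nonneg_left (by positivity) (by positivity)
      (mul_le_mul (h1 p) (h2 p) hη.le (norm_nonneg _))

end MomSymbol

lemma onShell_denominator_ge (x s : ℝ) {c : ℝ} (hc : 0 < c) :
    2 * c ≤ ‖(x : ℂ) + 2 * (s : ℂ) - 2 * I * (c : ℂ)‖ := by
  refine le_trans ?_ (Complex.abs_im_le_norm _)
  simp [abs_of_pos hc]

lemma selfEnergyIm_nonneg {d : ℕ} {B : 𝓢(Mom d, ℂ)} {T : ℝ → ℂ}
    (hT : ∀ u, 0 ≤ u → selfEnergy B u = T u) (hTi : ∀ u, (T u).im ≤ 0) (γ : ℝ) :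
    0 ≤ selfEnergyIm B γ := by
  unfold selfEnergyIm
  rcases lt_or_ge γ 0 with h | h
  · simp [selfEnergy_of_neg B h]
  · rw [hT γ h]
    linarith [hTi γ]

lemma onShellFun_bounds {d : ℕ} {B : 𝓢(Mom d, ℂ)} {lam η α β : ℝ}
    (hI : 0 ≤ selfEnergyIm B ((α + β) / 2)) (hη : 0 < η) (r : Mom d)
    {f : Mom d → ℂ} (hfc : Continuous f) {N : ℝ} (hf : ∀ x, ‖f x‖ ≤ N) :
    Continuous (onShellFun B lam η α β r f) ∧
      ∀ q, ‖onShellFun B lam η α β r f q‖ ≤ N / (2 * η) := by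
  have hc : η ≤ lam ^ 2 * selfEnergyIm B ((α + β) / 2) + η := by
    have := mul_nonneg (sq_nonneg lam) hI
    linarith
  have hD : ∀ p : Mom d, 2 * η ≤ ‖((α : ℂ) - (β : ℂ)) + 2 * ((inner ℝ p r : ℝ) : ℂ) -
      2 * I * ((lam ^ 2 * selfEnergyIm B ((α + β) / 2) + η : ℝ) : ℂ)‖ := by
    intro p
    have := onShell_denominator_ge (α - β) (inner ℝ p r) (hη.trans_le hc)
    rw [ofReal_sub] at this
    linarith
  have h0 : 0 < 2 * η := by positivity
  constructor
  · unfold onShellFun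
    exact hfc.div (by fun_prop) fun p => norm_pos_iff.1 (h0.trans_le (hD p))
  · intro q
    unfold onShellFun
    rw [norm_div]
    have hN : 0 ≤ N := (norm_nonneg _).trans (hf q)
    exact div_le_div₀ hN (hf q) h0 (hD q)

/-- The comparison of the two-resolvent integral with its on-shell value, for admissible
parameters. -/
lemma twoResolvent_estimate {d : ℕ} (hd : 3 ≤ d) {B : 𝓢(Mom d, ℂ)} {T : ℝ → ℂ} {K : ℝ}
    (hK : 0 ≤ K) (hTB : ∀ u, 0 ≤ u → selfEnergy B u = T u) (hTb : ∀ u, ‖T u‖ ≤ K)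
    (hT : ∀ u v, ‖T u - T v‖ ≤ K * √|u - v|) (hTi : ∀ u, (T u).im ≤ 0)
    {lam η α β : ℝ} {r : Mom d} {f : Mom d → ℂ}
    (hlam : 0 < lam) (hlam1 : lam ≤ 1) (hη : 0 < η)
    (hηl : η ≤ lam ^ 2) (hη4 : (9 + 4 * K ^ 2) * lam ^ 4 ≤ η) (hr : ‖r‖ ≤ lam ^ 2)
    (hf : ContDiff ℝ 1 f) (hN : weightedC1Norm (4 * d) f < ⊤) :
    Integrable (twoResolvent B lam η α β r f) ∧
    Integrable (fun q : Mom d => onShellFun B lam η α β r f q / ((‖q‖ : ℝ) : ℂ))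
      (shellMeasure d ((α + β) / 2)) ∧
    ‖(∫ p, twoResolvent B lam η α β r f p) -
        (-2 * (Real.pi : ℂ) * I * (lam : ℂ) ^ 2 *
          deltaIntegral (onShellFun B lam η α β r f) ((α + β) / 2))‖ ≤
      2 * d * rayConst K * ((volume : Measure (Mom d)).toSphere.real univ) *
        (lam ^ 3 / η + lam ^ 5 / η ^ 2) * (weightedC1Norm (4 * d) f).toReal := by
  set N := (weightedC1Norm (4 * d) f).toReal with hNdef
  have hN0 : 0 ≤ N := ENNReal.toReal_nonneg
  have hfN : ∀ x, ‖f x‖ ≤ N := fun x => by simpa using pow_mul_norm_le (k := 0) (by omega) hN x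
  have hTc := continuous_of_sqrt_modulus hT
  have hint : Integrable (twoResolvent B lam η α β r f) :=
    integrable_twoResolvent hTB hTc hTi hη α β r hf.continuous
      (integrable_of_weightedC1Norm (by omega) hf.continuous hN)
  obtain ⟨honc, honb⟩ := onShellFun_bounds (lam := lam)
    (selfEnergyIm_nonneg hTB hTi ((α + β) / 2)) hη r hf.continuous hfN
  refine ⟨hint, integrable_shellMeasure honc honb _, ?_⟩
  obtain ⟨hpi, hpe⟩ := integral_polar hd hint
  have hmain : Integrable (fun θ : Metric.sphere (0 : Mom d) 1 =>
      (-2 * (Real.pi : ℂ) * I * (lam : ℂ) ^ 2) * (√(2 * ((α + β) / 2)) ^ (d - 2) •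
        onShellFun B lam η α β r f (√(2 * ((α + β) / 2)) • (θ : Mom d))))
      (volume : Measure (Mom d)).toSphere := by
    have h0 : Integrable (fun θ : Metric.sphere (0 : Mom d) 1 =>
        onShellFun B lam η α β r f (√(2 * ((α + β) / 2)) • (θ : Mom d)))
        (volume : Measure (Mom d)).toSphere :=
      Integrable.of_bound (C := N / (2 * η)) (honc.comp (by fun_prop)).aestronglyMeasurable
        (Eventually.of_forall fun θ => honb _)
    have h1 := h0.smul (√(2 * ((α + β) / 2)) ^ (d - 2))
    exact h1.const_mul (-2 * (Real.pi : ℂ) * I * (lam : ℂ) ^ 2)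
  rw [hpe, deltaIntegral_eq hd honc, ← integral_const_mul, ← integral_sub hpi hmain]
  have hbound : ∀ θ : Metric.sphere (0 : Mom d) 1,
      ‖(∫ u in Ioi (0 : ℝ), √(2 * u) ^ (d - 2) •
          twoResolvent B lam η α β r f (√(2 * u) • (θ : Mom d))) -
        (-2 * (Real.pi : ℂ) * I * (lam : ℂ) ^ 2) * (√(2 * ((α + β) / 2)) ^ (d - 2) •
          onShellFun B lam η α β r f (√(2 * ((α + β) / 2)) • (θ : Mom d)))‖ ≤
      lam ^ 2 * (rayConst K * (2 * d * N) * (lam / η + lam ^ 3 / η ^ 2)) := by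
    intro θ
    have hθ : ‖(θ : Mom d)‖ = 1 := by simp
    set y := inner ℝ (θ : Mom d) r with hy
    have hyl : |y| ≤ lam ^ 2 := by
      refine (abs_real_inner_le_norm _ _).trans ?_
      rwa [hθ, one_mul]
    have hR2 : kin r ≤ lam ^ 4 := by
      unfold kin
      have : ‖r‖ ^ 2 ≤ (lam ^ 2) ^ 2 := by gcongr
      nlinarith [sq_nonneg ‖r‖]
    have key := ray_integral_estimate (α := α) (β := β) (g := rayDensity f (θ : Mom d)) hK hTb hT hTi
      hlam hlam1 hη hηl hη4 hyl (kin_nonneg r) hR2 (continuous_rayDensity hf.continuous)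
      (fun u hu => rayDensity_of_nonpos hd hu) (by positivity : 0 ≤ 2 * d * N)
      (norm_rayDensity_mul_le hd hθ hN) (norm_rayDensity_sub_le hd hθ hf hN)
    have e1 : ∫ u in Ioi (0 : ℝ), √(2 * u) ^ (d - 2) •
          twoResolvent B lam η α β r f (√(2 * u) • (θ : Mom d)) =
        (lam : ℂ) ^ 2 * ∫ u in Ioi 0, rayDensity f (θ : Mom d) u /
          ((starRingEnd ℂ) (raySymbol T lam η α (-y) (kin r) u) *
            raySymbol T lam η β y (kin r) u) := by
      rw [← integral_const_mul]
      refine setIntegral_congr_fun measurableSet_Ioi fun u hu => ?_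
      have hu : 0 ≤ u := le_of_lt hu
      have hk : kin (-r) = kin r := by simp [kin]
      beta_reduce
      rw [twoResolvent_eq hTB, sub_eq_add_neg, momSymbol_ray hθ _ hu, momSymbol_ray hθ _ hu,
        inner_neg_right, hk, ← hy, rayDensity, Complex.real_smul]
      ring
    have e2 : (-2 * (Real.pi : ℂ) * I * (lam : ℂ) ^ 2) * (√(2 * ((α + β) / 2)) ^ (d - 2) •
          onShellFun B lam η α β r f (√(2 * ((α + β) / 2)) • (θ : Mom d))) =
        (lam : ℂ) ^ 2 * (rayDensity f (θ : Mom d) ((α + β) / 2) *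
          (-2 * Real.pi * I / ((α : ℂ) - β + 2 * (√(2 * ((α + β) / 2)) * y : ℝ) -
        2 * I * ((η - lam ^ 2 * (T ((α + β) / 2)).im : ℝ) : ℂ)))) := by
      -- For γ < 0 the extension T and the self-energy may differ, but the density at γ is zero, so
      -- both sides vanish.
      rcases lt_or_ge ((α + β) / 2) 0 with hγ | hγ
      · have h0 : √(2 * ((α + β) / 2)) = 0 := Real.sqrt_eq_zero_of_nonpos (by linarith)
        have h1 : d - 2 ≠ 0 := by omega
        rw [rayDensity_of_nonpos hd hγ.le, h0, zero_pow h1]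
        simp
      · have hI : lam ^ 2 * selfEnergyIm B ((α + β) / 2) + η =
            η - lam ^ 2 * (T ((α + β) / 2)).im := by
          rw [selfEnergyIm, hTB _ hγ]; ring
        rw [onShellFun, hI, real_inner_smul_left, ← hy, rayDensity, Complex.real_smul]
        ring
    rw [e1, e2, ← mul_sub, norm_mul, norm_pow, Complex.norm_real, Real.norm_eq_abs, sq_abs]
    gcongr
  refine (norm_integral_le_of_norm_le_const (Eventually.of_forall hbound)).trans (le_of_eq ?_)
  field_simp

/-- The two bounds on η force κ ≥ 0, since λ < 1. The errors are then at most λ^(1-4κ) and λ^(1-8κ),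
and κ < 1/8 gives 1 - 8κ ≥ 1/2 - 4κ. -/
lemma scale_bounds {κ lam η K : ℝ} (hκ : κ < 1 / 8) (hlam : 0 < lam)
    (hlam0 : lam ≤ 1 / (9 + 4 * K ^ 2)) (hη1 : lam ^ (2 + 4 * κ) ≤ η) (hη2 : η ≤ lam ^ (2 + κ)) :
    lam ≤ 1 ∧ 0 < η ∧ η ≤ lam ^ 2 ∧ (9 + 4 * K ^ 2) * lam ^ 4 ≤ η ∧
      lam ^ (2 + κ / 4) ≤ lam ^ 2 ∧
      lam ^ 3 / η + lam ^ 5 / η ^ 2 ≤ 2 * lam ^ (1 / 2 - 4 * κ) := by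
  have hK : (9 : ℝ) ≤ 9 + 4 * K ^ 2 := by nlinarith [sq_nonneg K]
  have hK0 : 0 < 9 + 4 * K ^ 2 := by linarith
  have hlt : lam < 1 := by
    refine lt_of_le_of_lt hlam0 ?_
    rw [div_lt_one hK0]
    linarith
  have hlam1 : lam ≤ 1 := hlt.le
  have hmono : ∀ {x y : ℝ}, y ≤ x → lam ^ x ≤ lam ^ y := fun h =>
    Real.rpow_le_rpow_of_exponent_ge hlam hlam1 h
  have hη : 0 < η := lt_of_lt_of_le (by positivity) hη1
  have hκ0 : 0 ≤ κ := by
    have := (Real.rpow_le_rpow_left_iff_of_base_lt_one hlam hlt).1 (hη1.trans hη2)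
    linarith
  have hpow : ∀ n : ℕ, lam ^ n = lam ^ (n : ℝ) := fun n => (Real.rpow_natCast lam n).symm
  refine ⟨hlam1, hη, ?_, ?_, ?_, ?_⟩
  · rw [hpow 2]
    exact hη2.trans (hmono (by push_cast; linarith))
  · have h1 : (9 + 4 * K ^ 2) * lam ≤ 1 := by
      rw [le_div_iff₀ hK0] at hlam0
      linarith
    have h3 : lam ^ 3 ≤ η := by
      rw [hpow 3]
      exact (hmono (by push_cast; linarith)).trans hη1
    calc _ = ((9 + 4 * K ^ 2) * lam) * lam ^ 3 := by ring
      _ ≤ 1 * lam ^ 3 := by gcongr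
      _ ≤ η := by linarith
  · rw [hpow 2]
    exact hmono (by push_cast; linarith)
  · have h1 : lam ^ 3 / η ≤ lam ^ (1 / 2 - 4 * κ) := by
      rw [div_le_iff₀ hη]
      calc lam ^ 3 ≤ lam ^ ((1 / 2 - 4 * κ) + (2 + 4 * κ)) := by
            rw [hpow 3]; exact hmono (by push_cast; linarith)
        _ = lam ^ (1 / 2 - 4 * κ) * lam ^ (2 + 4 * κ) := Real.rpow_add hlam _ _
        _ ≤ _ := by gcongr
    have h2 : lam ^ 5 / η ^ 2 ≤ lam ^ (1 / 2 - 4 * κ) := by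
      rw [div_le_iff₀ (by positivity)]
      calc lam ^ 5 ≤ lam ^ ((1 / 2 - 4 * κ) + ((2 + 4 * κ) + (2 + 4 * κ))) := by
            rw [hpow 5]; exact hmono (by push_cast; linarith)
        _ = lam ^ (1 / 2 - 4 * κ) * (lam ^ (2 + 4 * κ) * lam ^ (2 + 4 * κ)) := by
            rw [Real.rpow_add hlam, Real.rpow_add hlam]
        _ ≤ lam ^ (1 / 2 - 4 * κ) * (η * η) := by gcongr
        _ = _ := by ring
    linarith

end RandomSchrodinger

end

/-! ### The theorem -/

theorem lemma6p1 (d : ℕ) (hd : 3 ≤ d)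
    (B : SchwartzMap (RandomSchrodinger.Mom d) ℂ)
    (hBrad : ∀ x y : RandomSchrodinger.Mom d, ‖x‖ = ‖y‖ → B x = B y)
    (hBsupp : (0 : RandomSchrodinger.Mom d) ∈
      tsupport (FourierTransform.fourier (B : RandomSchrodinger.Mom d → ℂ))) :
    -- the limits defining the self-energy exist and depend on `r` only through `e(r)`
    (∀ r : RandomSchrodinger.Mom d,
      Tendsto (fun ε : ℝ => RandomSchrodinger.selfEnergyReg B ε (RandomSchrodinger.kin r) r)
        (𝓝[>] (0 : ℝ)) (𝓝 (RandomSchrodinger.selfEnergy B (RandomSchrodinger.kin r)))) ∧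
    ∃ C : ℝ, 0 < C ∧ ∃ lam₀ : ℝ, 0 < lam₀ ∧
      ∀ (κ lam η α β : ℝ) (r : RandomSchrodinger.Mom d) (f : RandomSchrodinger.Mom d → ℂ),
        κ < 1 / 8 → 0 < lam → lam ≤ lam₀ →
        lam ^ (2 + 4 * κ) ≤ η → η ≤ lam ^ (2 + κ) →
        ‖r‖ ≤ lam ^ (2 + κ / 4) →
        ContDiff ℝ 1 f →
        RandomSchrodinger.weightedC1Norm (4 * d) f < ⊤ →
        Integrable (RandomSchrodinger.twoResolvent B lam η α β r f) volume ∧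
        Integrable (fun q : RandomSchrodinger.Mom d =>
            RandomSchrodinger.onShellFun B lam η α β r f q / ((‖q‖ : ℝ) : ℂ))
          (RandomSchrodinger.shellMeasure d ((α + β) / 2)) ∧
        ‖(∫ p, RandomSchrodinger.twoResolvent B lam η α β r f p) -
            (-2 * (Real.pi : ℂ) * Complex.I * (lam : ℂ) ^ 2 *
              RandomSchrodinger.deltaIntegral
                (RandomSchrodinger.onShellFun B lam η α β r f) ((α + β) / 2))‖
          ≤ C * lam ^ (1 / 2 - 4 * κ) *
              (RandomSchrodinger.weightedC1Norm (4 * d) f).toReal := by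
  refine ⟨fun r => ?_, ?_⟩
  · rw [RandomSchrodinger.selfEnergy_kin hd B hBrad]
    exact RandomSchrodinger.tendsto_selfEnergyReg hd B r
  obtain ⟨K, hK, T, hTB, hTb, hT, hTi⟩ := RandomSchrodinger.selfEnergy_regularity hd B hBrad
  set D : ℝ := 2 * d * RandomSchrodinger.rayConst K *
    ((volume : Measure (RandomSchrodinger.Mom d)).toSphere.real Set.univ) with hD
  have hD0 : 0 ≤ D := by
    have := RandomSchrodinger.rayConst_nonneg hK.le
    positivity
  -- The factor 2 counts the two error terms and the 1 only ensures positivity. The choice of λ₀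
  -- makes (9 + 4K²)λ⁴ ≤ λ³ ≤ η.
  refine ⟨2 * D + 1, by positivity, 1 / (9 + 4 * K ^ 2), by positivity, ?_⟩
  intro κ lam η α β r f hκ hlam hlam0 hη1 hη2 hr hf hN
  obtain ⟨hlam1, hη, hηl, hη4, hr2, hscale⟩ :=
    RandomSchrodinger.scale_bounds hκ hlam hlam0 hη1 hη2
  obtain ⟨h1, h2, h3⟩ := RandomSchrodinger.twoResolvent_estimate (α := α) (β := β) hd hK.le hTB hTb
    hT hTi hlam hlam1 hη hηl hη4 (hr.trans hr2) hf hN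
  refine ⟨h1, h2, h3.trans ?_⟩
  have hp : 0 ≤ lam ^ (1 / 2 - 4 * κ) := by positivity
  refine mul_le_mul_of_nonneg_right ?_ ENNReal.toReal_nonneg
  calc _ ≤ D * (2 * lam ^ (1 / 2 - 4 * κ)) := by gcongr
    _ ≤ _ := by linarith
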